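/- Let $\rho$ be a real quadratic irrationality, that is, an irrational real number with $A\rho^2+B\rho+C=0$ for some integers $A\neq 0$, $B$, $C$. Let $a,b,s$ be integers with $s\ge\max(a,b,1)+1$, and suppose that $s$ and $b$ have the same parity. Then the series $$\psi_s^{a,b}(\rho)=\sum_{n=1}^{\infty}\frac{\sec^a(\pi n\rho)\,\csc^b(\pi n\rho)}{n^s}$$ converges absolutely, and $\psi_s^{a,b}(\rho)\in\pi^s\,\mathbb{Q}(\rho)$. If, in addition, $\rho^2\in\mathbb{Q}$ and $a+b\ge 0$, then $\psi_s^{a,b}(\rho)\in(\pi\rho)^s\,\mathbb{Q}$. -/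

import Mathlib

/-- A real quadratic irrationality: an irrational real number that is a root of a quadratic
polynomial with integer coefficients. -/
def IsRealQuadraticIrrationality (ρ : ℝ) : Prop :=
  Irrational ρ ∧ ∃ A B C : ℤ, A ≠ 0 ∧ (A : ℝ) * ρ ^ 2 + (B : ℝ) * ρ + (C : ℝ) = 0

/-- The secant of a real number. -/
noncomputable def realSec (x : ℝ) : ℝ := 1 / Real.cos x

/-- The cosecant of a real number. -/
noncomputable def realCsc (x : ℝ) : ℝ := 1 / Real.sin x

/-- `trig^{a,b}(x) = sec^a(x) csc^b(x)`, for integers `a`, `b`. -/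
noncomputable def trigProd (a b : ℤ) (x : ℝ) : ℝ := realSec x ^ a * realCsc x ^ b

/-- The `n`-th term, `n ≥ 1`, of the trigonometric Dirichlet series `ψ_s^{a,b}(τ)`. -/
noncomputable def psiTerm (a b s : ℤ) (τ : ℝ) (n : ℕ+) : ℝ :=
  trigProd a b (Real.pi * (n : ℝ) * τ) / (n : ℝ) ^ s

/-- The trigonometric Dirichlet series
`ψ_s^{a,b}(τ) = ∑_{n ≥ 1} trig^{a,b}(π n τ) / n^s`. -/
noncomputable def psi (a b s : ℤ) (τ : ℝ) : ℝ := ∑' n : ℕ+, psiTerm a b s τ n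

namespace TrigDirichlet

open Filter Topology SummationFilter Polynomial

lemma hasSum_symmetricIcc_of_hasSum {f : ℤ → ℝ} {a : ℝ} (h : HasSum f a) :
    HasSum f a (symmetricIcc ℤ) :=
  Tendsto.mono_left h (LeAtTop.le_atTop.trans (by simp))

lemma Icc_neg_succ (N : ℕ) :
    Finset.Icc (-((N + 1 : ℕ) : ℤ)) ((N + 1 : ℕ) : ℤ) =
      insert ((N + 1 : ℕ) : ℤ) (insert (-((N + 1 : ℕ) : ℤ)) (Finset.Icc (-(N : ℤ)) N)) := by
  ext m
  simp only [Finset.mem_Icc, Finset.mem_insert]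
  push_cast
  omega

lemma sum_Icc_neg_succ (f : ℤ → ℝ) (N : ℕ) :
    ∑ m ∈ Finset.Icc (-((N + 1 : ℕ) : ℤ)) ((N + 1 : ℕ) : ℤ), f m =
      f (N + 1) + (f (-(N + 1)) + ∑ m ∈ Finset.Icc (-(N : ℤ)) N, f m) := by
  rw [Icc_neg_succ, Finset.sum_insert, Finset.sum_insert]
  · push_cast; rfl
  · simp
  · simp only [Finset.mem_insert, Finset.mem_Icc]
    push_cast
    omega

lemma sum_Icc_shift (f : ℤ → ℝ) (N : ℕ) :
    ∑ m ∈ Finset.Icc (-(N : ℤ)) N, f (m + 1) =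
      (∑ m ∈ Finset.Icc (-(N : ℤ)) N, f m) + f (N + 1) - f (-N) := by
  induction N with
  | zero => simp
  | succ N ih =>
    rw [sum_Icc_neg_succ, sum_Icc_neg_succ, ih]
    push_cast
    rw [show (-((N : ℤ) + 1) + 1) = -N by ring]
    ring

lemma hasSum_symmetricIcc_shift {f : ℤ → ℝ} {a : ℝ} (h : HasSum f a (symmetricIcc ℤ))
    (h0 : Tendsto f cofinite (𝓝 0)) : HasSum (fun m => f (m + 1)) a (symmetricIcc ℤ) := by
  rw [hasSum_symmetricIcc_iff] at h ⊢
  simp_rw [sum_Icc_shift]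
  have h1 : Tendsto (fun N : ℕ => f (N + 1)) atTop (𝓝 0) := by
    rw [← Nat.cofinite_eq_atTop]
    exact h0.comp (Function.Injective.tendsto_cofinite (fun a b hab => by simpa using hab))
  have h2 : Tendsto (fun N : ℕ => f (-N)) atTop (𝓝 0) := by
    rw [← Nat.cofinite_eq_atTop]
    exact h0.comp (Function.Injective.tendsto_cofinite (fun a b hab => by simpa using hab))
  simpa using (h.add h1).sub h2

lemma sum_Icc_neg (f : ℤ → ℝ) (N : ℕ) :
    ∑ m ∈ Finset.Icc (-(N : ℤ)) N, f (-m) = ∑ m ∈ Finset.Icc (-(N : ℤ)) N, f m := by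
  induction N with
  | zero => simp
  | succ N ih =>
    rw [sum_Icc_neg_succ, sum_Icc_neg_succ, ih, neg_neg]
    ring

lemma hasSum_symmetricIcc_neg {f : ℤ → ℝ} {a : ℝ} (h : HasSum f a (symmetricIcc ℤ)) :
    HasSum (fun m => f (-m)) a (symmetricIcc ℤ) := by
  rw [hasSum_symmetricIcc_iff] at h ⊢
  simpa only [sum_Icc_neg] using h

lemma tendsto_inv_add_int (x : ℝ) : Tendsto (fun m : ℤ => (x + m)⁻¹) cofinite (𝓝 0) :=
  tendsto_inv₀_cobounded.comp
    ((tendsto_const_add_cobounded x).comp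
      (by simpa using Int.tendsto_coe_cofinite))

lemma hasSum_inv_int_add (r : ℤ) :
    HasSum (fun m : ℤ => ((r : ℝ) + m)⁻¹) 0 (symmetricIcc ℤ) := by
  have key : ∀ r : ℕ, HasSum (fun m : ℤ => ((r : ℝ) + m)⁻¹) 0 (symmetricIcc ℤ) := by
    intro r
    induction r with
    | zero =>
      rw [hasSum_symmetricIcc_iff]
      have : ∀ N : ℕ, ∑ m ∈ Finset.Icc (-(N : ℤ)) N, (((0 : ℕ) : ℝ) + (m : ℝ))⁻¹ = 0 := by
        intro N
        have h := sum_Icc_neg (fun m : ℤ => (((0 : ℕ) : ℝ) + (m : ℝ))⁻¹) N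
        have h2 : ∑ m ∈ Finset.Icc (-(N : ℤ)) N, (((0 : ℕ) : ℝ) + ((-m : ℤ) : ℝ))⁻¹ =
            - ∑ m ∈ Finset.Icc (-(N : ℤ)) N, (((0 : ℕ) : ℝ) + (m : ℝ))⁻¹ := by
          rw [← Finset.sum_neg_distrib]
          exact Finset.sum_congr rfl fun m _ => by
            rw [← inv_neg]; congr 1; push_cast; ring
        linarith
      simp only [this]
      exact tendsto_const_nhds
    | succ r ih =>
      have := hasSum_symmetricIcc_shift ih (tendsto_inv_add_int _)
      convert this using 2 with m
      push_cast
      ring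
  obtain ⟨n, rfl | rfl⟩ := r.eq_nat_or_neg
  · exact_mod_cast key n
  · have h := hasSum_symmetricIcc_neg (key n)
    have h' := h.neg
    rw [neg_zero] at h'
    have e : (fun m : ℤ => -(((n : ℕ) : ℝ) + ((-m : ℤ) : ℝ))⁻¹) =
        fun m : ℤ => (((-(n : ℤ) : ℤ) : ℝ) + m)⁻¹ := by
      funext m
      rw [← inv_neg]
      congr 1
      push_cast
      ring
    exact e ▸ h'

/-- Partial fraction expansion of the cotangent, summed symmetrically. -/
lemma hasSum_inv_add_int {x : ℝ} (hx : ∀ m : ℤ, x ≠ m) :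
    HasSum (fun m : ℤ => (x + m)⁻¹) (Real.pi * Real.cot (Real.pi * x)) (symmetricIcc ℤ) := by
  have hx' : (x : ℂ) ∈ Complex.integerComplement := by
    rintro ⟨m, hm⟩
    exact hx m (by exact_mod_cast hm.symm)
  rw [hasSum_symmetricIcc_iff]
  have h := (tendsto_logDeriv_euler_cot_sub hx').const_add (1 / (x : ℂ))
  rw [add_sub_cancel] at h
  have h' := (Complex.continuous_re.tendsto _).comp h
  have e1 : ((Real.pi : ℂ) * ((Real.pi : ℂ) * (x : ℂ)).cot).re =
      Real.pi * Real.cot (Real.pi * x) := by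
    rw [← Complex.ofReal_mul, ← Complex.ofReal_cot, ← Complex.ofReal_mul, Complex.ofReal_re]
  rw [e1] at h'
  refine h'.congr fun N => ?_
  simp only [Function.comp]
  induction N with
  | zero =>
    simp only [Finset.range_zero, Finset.sum_empty, add_zero]
    rw [← Complex.ofReal_one, ← Complex.ofReal_div, Complex.ofReal_re]
    simp
  | succ N ih =>
    rw [sum_Icc_neg_succ, ← ih, Finset.sum_range_succ, ← add_assoc, Complex.add_re]
    have : (cotTerm (x : ℂ) N) =
        (((x + ((N + 1 : ℤ) : ℝ))⁻¹ + (x + ((-(N + 1) : ℤ) : ℝ))⁻¹ : ℝ) : ℂ) := by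
      unfold cotTerm
      push_cast
      simp only [one_div]
      rw [add_comm]
      congr 2
    rw [this, Complex.ofReal_re]
    ring

lemma summable_inv_add_int_pow (x : ℝ) {k : ℕ} (hk : 2 ≤ k) :
    Summable fun m : ℤ => |(x + m)⁻¹| ^ k := by
  have := (Real.summable_one_div_int_add_rpow x k).2 (by exact_mod_cast hk)
  refine this.congr fun m => ?_
  rw [Real.rpow_natCast, abs_inv, inv_pow, one_div, add_comm]

/-- Polynomials `P_k` with `∑_m (x + m)^{-(k+1)} = π ^ (k+1) P_k (cot π x)`. -/
noncomputable def cotPoly : ℕ → ℚ[X]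
  | 0 => X
  | k + 1 => C (1 / (k + 1 : ℚ)) * ((1 + X ^ 2) * derivative (cotPoly k))

lemma natDegree_cotPoly_le (k : ℕ) : (cotPoly k).natDegree ≤ k + 1 := by
  induction k with
  | zero => simp [cotPoly]
  | succ k ih =>
    have h1 : (derivative (cotPoly k)).natDegree ≤ k := by
      have := natDegree_derivative_le (cotPoly k)
      omega
    have h2 : ((1 : ℚ[X]) + X ^ 2).natDegree ≤ 2 := by compute_degree
    have h3 := natDegree_mul_le (p := (1 : ℚ[X]) + X ^ 2) (q := derivative (cotPoly k))
    have h4 := natDegree_C_mul_le (1 / (k + 1 : ℚ)) ((1 + X ^ 2) * derivative (cotPoly k))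
    rw [cotPoly]
    omega

lemma coeff_cotPoly_succ (k : ℕ) : (cotPoly k).coeff (k + 1) = 1 := by
  induction k with
  | zero => simp [cotPoly]
  | succ k ih =>
    have h1 : (derivative (cotPoly k)).coeff (k + 2) = 0 := by
      apply coeff_eq_zero_of_natDegree_lt
      have := natDegree_derivative_le (cotPoly k)
      have := natDegree_cotPoly_le k
      omega
    rw [cotPoly, coeff_C_mul, add_mul, one_mul, coeff_add, h1, zero_add,
      mul_comm (X ^ 2), coeff_mul_X_pow, coeff_derivative, ih]
    field_simp

lemma hasDerivAt_cot {x : ℝ} (hx : Real.sin x ≠ 0) :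
    HasDerivAt Real.cot (-(1 + Real.cot x ^ 2)) x := by
  have h := (Real.hasDerivAt_cos x).div (Real.hasDerivAt_sin x) hx
  have e : Real.cot = fun y => Real.cos y / Real.sin y := funext Real.cot_eq_cos_div_sin
  rw [e]
  refine h.congr_deriv ?_
  field_simp
  ring

lemma sin_pi_mul_ne_zero {x : ℝ} (hx : ∀ m : ℤ, x ≠ m) : Real.sin (Real.pi * x) ≠ 0 := by
  intro h
  obtain ⟨m, hm⟩ := Real.sin_eq_zero_iff.1 h
  apply hx m
  have := Real.pi_ne_zero
  rw [mul_comm] at hm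
  exact (mul_left_cancel₀ this hm).symm

lemma isOpen_compl_int : IsOpen {x : ℝ | ∀ m : ℤ, x ≠ m} := by
  have : {x : ℝ | ∀ m : ℤ, x ≠ m} = (Set.range ((↑) : ℤ → ℝ))ᶜ := by
    ext x
    simp [eq_comm]
  rw [this]
  exact Int.isClosedEmbedding_coe_real.isClosed_range.isOpen_compl

lemma hasDerivAt_inv_add_pow {y : ℝ} (m : ℝ) (k : ℕ) (h : y + m ≠ 0) :
    HasDerivAt (fun y : ℝ => ((y + m)⁻¹) ^ (k + 1)) (-(k + 1) * ((y + m)⁻¹) ^ (k + 2)) y := by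
  have h1 := (((hasDerivAt_id y).add_const m).inv h).pow (k + 1)
  simp only [id] at h1
  refine h1.congr_deriv ?_
  push_cast
  simp only [Pi.inv_apply]
  rw [div_eq_mul_inv, ← inv_pow]
  ring

/-- The partial fraction expansion of the polynomials `cotPoly` in the cotangent. -/
lemma hasSum_inv_add_int_pow (k : ℕ) {x : ℝ} (hx : ∀ m : ℤ, x ≠ m) :
    HasSum (fun m : ℤ => ((x + m)⁻¹) ^ (k + 1))
      (Real.pi ^ (k + 1) * aeval (Real.cot (Real.pi * x)) (cotPoly k)) (symmetricIcc ℤ) := by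
  induction k generalizing x with
  | zero => simpa [cotPoly] using hasSum_inv_add_int hx
  | succ k ih =>
    obtain ⟨r, hr, hball⟩ := Metric.isOpen_iff.1 isOpen_compl_int x hx
    have hdist : ∀ m : ℤ, r ≤ |x + m| := by
      intro m
      by_contra! hlt
      have : ((-m : ℤ) : ℝ) ∈ Metric.ball x r := by
        rw [Metric.mem_ball, Real.dist_eq, abs_sub_comm]
        push_cast
        simpa using hlt
      exact hball this (-m) rfl
    have hb : ∀ m : ℤ, ∀ y ∈ Metric.ball x (r / 2), |x + m| / 2 ≤ |y + m| := by
      intro m y hy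
      rw [Metric.mem_ball, Real.dist_eq] at hy
      have h1 := hdist m
      have h2 := abs_sub_abs_le_abs_sub (x + m) (y + m)
      have h3 : |x + m - (y + m)| = |y - x| := by
        rw [abs_sub_comm]; congr 1; ring
      linarith
    have hne : ∀ m : ℤ, ∀ y ∈ Metric.ball x (r / 2), y + m ≠ 0 := by
      intro m y hy h0
      have h1 := hb m y hy
      have h2 := hdist m
      rw [h0, abs_zero] at h1
      linarith
    set u : ℤ → ℝ := fun m => (k + 1) * 2 ^ (k + 2) * |(x + m)⁻¹| ^ (k + 2) with hu_def
    have hu : Summable u := (summable_inv_add_int_pow x (by omega)).mul_left _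
    set g : ℤ → ℝ → ℝ := fun m y => ((y + m)⁻¹) ^ (k + 1) - ((x + m)⁻¹) ^ (k + 1) with hg_def
    set g' : ℤ → ℝ → ℝ := fun m y => -(k + 1) * ((y + m)⁻¹) ^ (k + 2) with hg'_def
    have hg : ∀ m : ℤ, ∀ y ∈ Metric.ball x (r / 2), HasDerivAt (g m) (g' m y) y :=
      fun m y hy => (hasDerivAt_inv_add_pow (m : ℝ) k (hne m y hy)).sub_const _
    have hg' : ∀ m : ℤ, ∀ y ∈ Metric.ball x (r / 2), ‖g' m y‖ ≤ u m := by
      intro m y hy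
      have h1 : |(y + m)⁻¹| ≤ 2 * |(x + m)⁻¹| := by
        have hp : 0 < |x + m| := lt_of_lt_of_le hr (hdist m)
        rw [abs_inv, abs_inv]
        calc |y + m|⁻¹ ≤ (|x + m| / 2)⁻¹ := by
              apply inv_anti₀ (by positivity) (hb m y hy)
          _ = 2 * |x + m|⁻¹ := by field_simp
      simp only [hg'_def, hu_def, norm_mul, norm_neg, norm_pow, Real.norm_eq_abs]
      rw [abs_of_nonneg (by positivity : (0 : ℝ) ≤ k + 1), mul_assoc, ← mul_pow]
      gcongr
    have hx0 : x ∈ Metric.ball x (r / 2) := Metric.mem_ball_self (by linarith)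
    have hpre : IsPreconnected (Metric.ball x (r / 2)) := (convex_ball x _).isPreconnected
    have hsum0 : Summable fun m => g m x := by
      simp only [hg_def, sub_self]
      exact summable_zero
    have hder := hasDerivAt_tsum_of_isPreconnected hu Metric.isOpen_ball hpre hg hg' hx0 hsum0 hx0
    have hval : ∀ y ∈ Metric.ball x (r / 2), ∑' m, g m y =
        Real.pi ^ (k + 1) * aeval (Real.cot (Real.pi * y)) (cotPoly k) -
        Real.pi ^ (k + 1) * aeval (Real.cot (Real.pi * x)) (cotPoly k) := by
      intro y hy
      have hs := summable_of_summable_hasDerivAt_of_isPreconnected hu Metric.isOpen_ball hpre hg hg'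
        hx0 hsum0 hy
      have hy' : ∀ m : ℤ, y ≠ m := hball (Metric.ball_subset_ball (by linarith) hy)
      exact (hasSum_symmetricIcc_of_hasSum hs.hasSum).unique ((ih hy').sub (ih hx))
    have hder2 : HasDerivAt (fun y => ∑' m, g m y)
        (Real.pi ^ (k + 1) * (aeval (Real.cot (Real.pi * x)) (derivative (cotPoly k)) *
          (-(1 + Real.cot (Real.pi * x) ^ 2) * Real.pi))) x := by
      have h1 : HasDerivAt (fun y => Real.cot (Real.pi * y))
          (-(1 + Real.cot (Real.pi * x) ^ 2) * Real.pi) x := by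
        have h := (hasDerivAt_cot (sin_pi_mul_ne_zero hx)).comp x
          ((hasDerivAt_id x).const_mul Real.pi)
        simpa using! h
      have h2 := (cotPoly k).hasDerivAt_aeval (Real.cot (Real.pi * x))
      have h3 := ((h2.comp x h1).const_mul (Real.pi ^ (k + 1))).sub_const
        (Real.pi ^ (k + 1) * aeval (Real.cot (Real.pi * x)) (cotPoly k))
      refine h3.congr_of_eventuallyEq ?_
      filter_upwards [Metric.ball_mem_nhds x (by linarith : 0 < r / 2)] with y hy
      exact hval y hy
    have heq := hder.unique hder2
    have hs : Summable fun m : ℤ => ((x + m)⁻¹) ^ (k + 2) := by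
      refine Summable.of_abs ((summable_inv_add_int_pow x (by omega : 2 ≤ k + 2)).congr fun m => ?_)
      rw [abs_pow]
    have hfin : ∑' m : ℤ, ((x + m)⁻¹) ^ (k + 2) = Real.pi ^ (k + 1 + 1) *
        aeval (Real.cot (Real.pi * x)) (cotPoly (k + 1)) := by
      simp only [hg'_def, tsum_mul_left] at heq
      have hk : ((k : ℝ) + 1) ≠ 0 := by positivity
      have : ∑' m : ℤ, ((x + m)⁻¹) ^ (k + 2) = (Real.pi ^ (k + 1) *
          (aeval (Real.cot (Real.pi * x)) (derivative (cotPoly k)) *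
          ((1 + Real.cot (Real.pi * x) ^ 2) * Real.pi))) / (k + 1) := by
        rw [eq_div_iff hk]
        linarith
      rw [this, cotPoly]
      simp only [map_mul, map_add, map_one, map_pow, aeval_X, aeval_C]
      simp only [map_div₀, map_add, map_one, map_natCast]
      field_simp
      ring
    rw [← hfin]
    exact hasSum_symmetricIcc_of_hasSum hs.hasSum

end TrigDirichlet

namespace TrigDirichlet

open Filter Topology SummationFilter Polynomial

lemma hasSum_of_eq {ι α : Type*} [AddCommMonoid α] [TopologicalSpace α] {L : SummationFilter ι}
    {f g : ι → α} {a b : α} (h : HasSum f a L) (hf : ∀ i, g i = f i) (hb : b = a) :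
    HasSum g b L := by
  rw [hb, funext hf]
  exact h

/-- The symmetrically summed series `∑_m (x + m)^{-k}`, omitting a vanishing denominator. -/
noncomputable def cotSum (k : ℕ) (x : ℝ) : ℝ := ∑'[symmetricIcc ℤ] m : ℤ, ((x + m)⁻¹) ^ k

lemma cotSum_eq {x : ℝ} (hx : ∀ m : ℤ, x ≠ m) (k : ℕ) :
    cotSum (k + 1) x = Real.pi ^ (k + 1) * aeval (Real.cot (Real.pi * x)) (cotPoly k) :=
  (hasSum_inv_add_int_pow k hx).tsum_eq

/-- Additive characters of `ℤ` of finite order, up to powers of `I`. -/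
noncomputable def rationalPhase : Submonoid (ℤ → ℂ) where
  carrier := {g | ∃ (u : ℕ) (α : ℚ), g = fun n : ℤ =>
    Complex.I ^ u * Complex.exp (2 * Real.pi * Complex.I * n * α)}
  one_mem' := ⟨0, 0, by funext n; simp⟩
  mul_mem' := by
    rintro _ _ ⟨u, α, rfl⟩ ⟨v, β, rfl⟩
    refine ⟨u + v, α + β, funext fun n => ?_⟩
    simp only [Pi.mul_apply]
    rw [pow_add, Rat.cast_add, mul_add (2 * (Real.pi : ℂ) * Complex.I * n), Complex.exp_add]
    ring

/-- The algebra of periodic functions on `ℤ` spanned by `rationalPhase`. -/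
noncomputable def phaseAlgebra : Subalgebra ℚ (ℤ → ℂ) := Algebra.adjoin ℚ (rationalPhase : Set (ℤ → ℂ))

lemma exists_I_pow (m : ℕ) : ∃ p q : ℚ, Complex.I ^ m = p + q * Complex.I := by
  induction m with
  | zero => exact ⟨1, 0, by simp⟩
  | succ m ih =>
    obtain ⟨p, q, h⟩ := ih
    refine ⟨-q, p, ?_⟩
    rw [pow_succ, h]
    push_cast
    linear_combination (q : ℂ) * Complex.I_mul_I

lemma exp_fract (n : ℤ) (α : ℚ) :
    Complex.exp (2 * Real.pi * Complex.I * n * ((Int.fract α : ℚ) : ℂ)) =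
      Complex.exp (2 * Real.pi * Complex.I * n * α) := by
  rw [Complex.exp_eq_exp_iff_exists_int]
  refine ⟨-(n * ⌊α⌋), ?_⟩
  have : ((Int.fract α : ℚ) : ℂ) = α - (⌊α⌋ : ℂ) := by
    rw [← Int.self_sub_floor]
    push_cast
    rfl
  rw [this]
  push_cast
  ring

lemma hasSum_exp_div_pow {i : ℕ} (hi : 2 ≤ i) (α : ℚ) :
    ∃ r : ℚ, HasSum (fun n : ℤ => Complex.exp (2 * Real.pi * Complex.I * n * α) * ((n : ℂ)⁻¹) ^ i)
      ((Real.pi : ℂ) ^ i * (Complex.I ^ i * r)) := by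
  have hx : ((Int.fract α : ℚ) : ℝ) ∈ Set.Icc (0 : ℝ) 1 :=
    ⟨by exact_mod_cast Int.fract_nonneg α, by exact_mod_cast (Int.fract_lt_one α).le⟩
  have h := hasSum_one_div_pow_mul_fourier_mul_bernoulliFun hi hx
  refine ⟨-2 ^ i / i.factorial * (Polynomial.bernoulli i).eval (Int.fract α), ?_⟩
  have hB : bernoulliFun i ((Int.fract α : ℚ) : ℝ) =
      (((Polynomial.bernoulli i).eval (Int.fract α) : ℚ) : ℝ) := by
    unfold bernoulliFun
    rw [eval_map]
    exact eval₂_at_apply (algebraMap ℚ ℝ) _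
  rw [hB] at h
  refine hasSum_of_eq h (fun n => ?_) ?_
  · rw [fourier_coe_apply, ← exp_fract, mul_comm, one_div, inv_pow, Complex.ofReal_ratCast]
    simp
  · push_cast
    ring

lemma hasSum_phase {i : ℕ} (hi : 2 ≤ i) {g : ℤ → ℂ} (hg : g ∈ phaseAlgebra) :
    ∃ p q : ℚ, HasSum (fun n : ℤ => g n * ((n : ℂ)⁻¹) ^ i)
      ((Real.pi : ℂ) ^ i * (p + q * Complex.I)) := by
  rw [phaseAlgebra, ← Subalgebra.mem_toSubmodule, Algebra.adjoin_eq_span,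
    Submonoid.closure_eq] at hg
  induction hg using Submodule.span_induction with
  | mem g hg =>
    obtain ⟨u, α, rfl⟩ := hg
    obtain ⟨r, hr⟩ := hasSum_exp_div_pow hi α
    obtain ⟨p, q, hpq⟩ := exists_I_pow (u + i)
    refine ⟨p * r, q * r, ?_⟩
    refine hasSum_of_eq (hr.mul_left (Complex.I ^ u)) (fun n => ?_) ?_
    · ring
    · push_cast
      rw [pow_add] at hpq
      linear_combination (-(Real.pi : ℂ) ^ i * r) * hpq
  | zero => exact ⟨0, 0, by simp⟩
  | add f g _ _ hf hg =>
    obtain ⟨p, q, h⟩ := hf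
    obtain ⟨p', q', h'⟩ := hg
    refine ⟨p + p', q + q', ?_⟩
    refine hasSum_of_eq (h.add h') (fun n => ?_) ?_
    · simp only [Pi.add_apply]
      ring
    · push_cast
      ring
  | smul a g _ hg =>
    obtain ⟨p, q, h⟩ := hg
    refine ⟨a * p, a * q, ?_⟩
    refine hasSum_of_eq (h.mul_left (a : ℂ)) (fun n => ?_) ?_
    · simp only [Pi.smul_apply, Rat.smul_def]
      ring
    · push_cast
      ring

lemma hasSum_phase_real {i : ℕ} (hi : 2 ≤ i) {g : ℤ → ℝ}
    (hg : (fun n => (g n : ℂ)) ∈ phaseAlgebra) :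
    ∃ p : ℚ, HasSum (fun n : ℤ => g n * ((n : ℝ)⁻¹) ^ i) (Real.pi ^ i * p) := by
  obtain ⟨p, q, h⟩ := hasSum_phase hi hg
  refine ⟨p, ?_⟩
  have h2 := ((Complex.hasSum_iff _ _).1 h).1
  refine hasSum_of_eq h2 (fun n => ?_) ?_
  · have : (g n : ℂ) * ((n : ℂ)⁻¹) ^ i = ((g n * ((n : ℝ)⁻¹) ^ i : ℝ) : ℂ) := by push_cast; rfl
    rw [this, Complex.ofReal_re]
  · have : (Real.pi : ℂ) ^ i * (p + q * Complex.I) =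
        ((Real.pi ^ i * p : ℝ) : ℂ) + ((Real.pi ^ i * q : ℝ) : ℂ) * Complex.I := by
      push_cast; ring
    rw [this, Complex.add_re, Complex.ofReal_re, Complex.re_ofReal_mul, Complex.I_re]
    ring

lemma hasSum_zeta_int {k : ℕ} (hk : 2 ≤ k) :
    ∃ q : ℚ, HasSum (fun m : ℤ => ((m : ℝ)⁻¹) ^ k) (Real.pi ^ k * q) := by
  obtain ⟨q, hq⟩ := hasSum_phase_real (g := fun _ => 1) hk (by
    have : (fun _ : ℤ => ((1 : ℝ) : ℂ)) = 1 := by funext; simp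
    rw [this]
    exact one_mem _)
  exact ⟨q, by simpa using hq⟩

lemma hasSum_inv_int_add_pow {k : ℕ} (hk : 1 ≤ k) :
    ∃ q : ℚ, ∀ r : ℤ, HasSum (fun m : ℤ => (((r : ℝ) + m)⁻¹) ^ k) (Real.pi ^ k * q)
      (symmetricIcc ℤ) := by
  rcases hk.eq_or_lt with rfl | hk
  · exact ⟨0, fun r => by simpa using hasSum_inv_int_add r⟩
  · obtain ⟨q, hq⟩ := hasSum_zeta_int hk
    refine ⟨q, fun r => hasSum_symmetricIcc_of_hasSum ?_⟩
    have := (Equiv.addLeft r).hasSum_iff.2 hq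
    exact hasSum_of_eq this (fun m => by simp) rfl

lemma hasSum_cotSum {k : ℕ} (hk : 1 ≤ k) (x : ℝ) :
    HasSum (fun m : ℤ => ((x + m)⁻¹) ^ k) (cotSum k x) (symmetricIcc ℤ) := by
  refine Summable.hasSum ?_
  by_cases hx : ∀ m : ℤ, x ≠ m
  · obtain ⟨j, rfl⟩ : ∃ j, k = j + 1 := ⟨k - 1, by omega⟩
    exact (hasSum_inv_add_int_pow j hx).summable
  · push Not at hx
    obtain ⟨r, rfl⟩ := hx
    obtain ⟨q, hq⟩ := hasSum_inv_int_add_pow hk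
    exact (hq r).summable

lemma cotSum_int {k : ℕ} (hk : 1 ≤ k) : ∃ q : ℚ, ∀ r : ℤ, cotSum k r = Real.pi ^ k * q := by
  obtain ⟨q, hq⟩ := hasSum_inv_int_add_pow hk
  exact ⟨q, fun r => (hq r).tsum_eq⟩

lemma sum_range_mul_pow (z : ℂ) (N : ℕ) :
    (z - 1) * ∑ t ∈ Finset.range N, (t : ℂ) * z ^ t =
      N * z ^ N - z * ∑ t ∈ Finset.range N, z ^ t := by
  induction N with
  | zero => simp
  | succ N ih =>
    rw [Finset.sum_range_succ, Finset.sum_range_succ, mul_add, ih]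
    push_cast
    ring

section RationalPoint

variable {x : ℝ} {N : ℕ}

lemma exp_eq_one_iff_int :
    Complex.exp (2 * Real.pi * Complex.I * x) = 1 ↔ ∃ m : ℤ, x = m := by
  rw [Complex.exp_eq_one_iff]
  refine exists_congr fun m => ?_
  have h : (2 * (Real.pi : ℂ) * Complex.I) ≠ 0 := Complex.two_pi_I_ne_zero
  rw [mul_comm (m : ℂ), mul_right_inj' h]
  norm_cast

lemma exp_pow_eq_one (hN : ∃ r : ℤ, N * x = r) :
    Complex.exp (2 * Real.pi * Complex.I * x) ^ N = 1 := by
  obtain ⟨r, hr⟩ := hN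
  rw [← Complex.exp_nat_mul, Complex.exp_eq_one_iff]
  refine ⟨r, ?_⟩
  have : (N : ℂ) * x = r := by exact_mod_cast hr
  linear_combination (2 * (Real.pi : ℂ) * Complex.I) * this

lemma sum_exp_pow [DecidableEq ℝ] (hN : ∃ r : ℤ, N * x = r) [Decidable (∃ m : ℤ, x = m)] :
    ∑ t ∈ Finset.range N, Complex.exp (2 * Real.pi * Complex.I * x) ^ t =
      if ∃ m : ℤ, x = m then (N : ℂ) else 0 := by
  split_ifs with h
  · rw [exp_eq_one_iff_int.2 h]
    simp
  · have h1 : Complex.exp (2 * Real.pi * Complex.I * x) ≠ 1 := fun h' => h (exp_eq_one_iff_int.1 h')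
    rw [geom_sum_eq h1, exp_pow_eq_one hN]
    simp

/-- The finite Fourier expansion of the cotangent at a rational point. -/
lemma cot_eq_sum_exp (hN0 : 0 < N) (hN : ∃ r : ℤ, N * x = r) :
    ((Real.cot (Real.pi * x) : ℝ) : ℂ) = Complex.I * (1 +
      ∑ t ∈ Finset.range N, ((2 * t / N - 1 : ℚ) : ℂ) *
        Complex.exp (2 * Real.pi * Complex.I * x) ^ t) := by
  classical
  have hN' : (N : ℂ) ≠ 0 := by exact_mod_cast hN0.ne'
  rw [Complex.ofReal_cot, Complex.ofReal_mul, Complex.cot_pi_eq_exp_ratio]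
  have hgeom := sum_exp_pow hN
  have hz := exp_pow_eq_one hN
  have hiff := exp_eq_one_iff_int (x := x)
  set z := Complex.exp (2 * Real.pi * Complex.I * x) with hz_def
  have hsum : ∑ t ∈ Finset.range N, ((2 * t / N - 1 : ℚ) : ℂ) * z ^ t =
      2 / N * ∑ t ∈ Finset.range N, (t : ℂ) * z ^ t - ∑ t ∈ Finset.range N, z ^ t := by
    rw [Finset.mul_sum, ← Finset.sum_sub_distrib]
    refine Finset.sum_congr rfl fun t _ => ?_
    push_cast
    ring
  rw [hsum]
  by_cases h1 : z = 1
  · rw [h1]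
    simp only [sub_self, mul_zero, div_zero, one_pow, mul_one, Finset.sum_const, Finset.card_range,
      nsmul_eq_mul]
    have h2 : (∑ t ∈ Finset.range N, (t : ℂ)) * 2 = N * (N - 1) := by
      have := Finset.sum_range_id_mul_two N
      have h3 : ((∑ t ∈ Finset.range N, t : ℕ) : ℂ) * 2 = N * ((N - 1 : ℕ) : ℂ) := by
        exact_mod_cast this
      rw [Nat.cast_sub hN0] at h3
      push_cast at h3
      exact h3
    symm
    rw [mul_eq_zero]
    right
    field_simp
    linear_combination h2
  · have h0 := sum_range_mul_pow z N
    have hne : ¬ ∃ m : ℤ, x = m := fun h => h1 (hiff.2 h)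
    rw [if_neg hne] at hgeom
    rw [hgeom, hz] at h0
    rw [hgeom]
    have hz1 : z - 1 ≠ 0 := sub_ne_zero.2 h1
    have hz2 : 1 - z ≠ 0 := sub_ne_zero.2 (Ne.symm h1)
    have h3 : ∑ t ∈ Finset.range N, (t : ℂ) * z ^ t = N / (z - 1) := by
      rw [eq_div_iff hz1]
      linear_combination h0
    rw [h3]
    field_simp
    linear_combination (-(z + 1) * (1 - z) - 2 * 0) * Complex.I_sq

end RationalPoint

lemma aeval_mem_phaseAlgebra {f : ℤ → ℂ} (hf : f ∈ phaseAlgebra) (p : ℚ[X]) :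
    (fun n => aeval (f n) p) ∈ phaseAlgebra := by
  have h : aeval f p ∈ phaseAlgebra :=
    Algebra.adjoin_le (by simpa using hf) (aeval_mem_adjoin_singleton ℚ f)
  convert h using 1
  funext n
  exact (aeval_algHom_apply (Pi.evalAlgHom ℚ (fun _ : ℤ => ℂ) n) f p)

lemma exp_mem_phaseAlgebra (h : ℕ) (β : ℚ) (t : ℕ) :
    (fun n : ℤ => Complex.exp (2 * Real.pi * Complex.I * (((h : ℝ) / 4 + n * β : ℝ) : ℂ)) ^ t) ∈
      phaseAlgebra := by
  refine Algebra.subset_adjoin ⟨h * t, β * t, funext fun n => ?_⟩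
  have hI : Complex.I ^ (h * t) =
      Complex.exp (((h * t : ℕ) : ℂ) * (Real.pi / 2 * Complex.I)) := by
    rw [Complex.exp_nat_mul, Complex.exp_pi_div_two_mul_I]
  rw [← Complex.exp_nat_mul, hI, ← Complex.exp_add]
  congr 1
  push_cast
  ring


/-- Sums of `cotSum` over a rational arithmetic progression are rational multiples of powers
of `π`. -/
lemma hasSum_cotSum_rational {k i : ℕ} (hk : 1 ≤ k) (hi : 2 ≤ i) (h : ℕ) (β : ℚ) :
    ∃ p : ℚ, HasSum (fun n : ℤ => cotSum k ((h : ℝ) / 4 + n * β) * ((n : ℝ)⁻¹) ^ i)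
      (Real.pi ^ (k + i) * p) := by
  classical
  obtain ⟨q, hq⟩ := cotSum_int hk
  obtain ⟨j, rfl⟩ : ∃ j, k = j + 1 := ⟨k - 1, by omega⟩
  set N : ℕ := 4 * β.den with hN_def
  have hN0 : 0 < N := by have := β.den_pos; omega
  have hN : ∀ n : ℤ, ∃ r : ℤ, N * ((h : ℝ) / 4 + n * β) = r := by
    intro n
    refine ⟨h * β.den + 4 * n * β.num, ?_⟩
    have h1 : (β.den : ℝ) * β = β.num := by exact_mod_cast Rat.den_mul_eq_num β
    rw [hN_def]
    push_cast
    linear_combination (4 * (n : ℝ)) * h1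
  set x : ℤ → ℝ := fun n => (h : ℝ) / 4 + n * β with hx_def
  have hcot : (fun n => ((Real.cot (Real.pi * x n) : ℝ) : ℂ)) ∈ phaseAlgebra := by
    have e : (fun n => ((Real.cot (Real.pi * x n) : ℝ) : ℂ)) =
        (fun _ => Complex.I) * (1 + ∑ t ∈ Finset.range N, (2 * t / N - 1 : ℚ) •
          fun n => Complex.exp (2 * Real.pi * Complex.I * (x n : ℂ)) ^ t) := by
      funext n
      rw [cot_eq_sum_exp hN0 (hN n)]
      simp [Finset.sum_apply, Rat.smul_def, hx_def]
    rw [e]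
    refine mul_mem (Algebra.subset_adjoin ⟨1, 0, by funext n; simp⟩) (add_mem (one_mem _) ?_)
    exact sum_mem fun t _ => Subalgebra.smul_mem _ (exp_mem_phaseAlgebra h β t) _
  have hind : (fun n => if ∃ m : ℤ, x n = m then (1 : ℂ) else 0) ∈ phaseAlgebra := by
    have e : (fun n => if ∃ m : ℤ, x n = m then (1 : ℂ) else 0) =
        (1 / N : ℚ) • ∑ t ∈ Finset.range N,
          fun n => Complex.exp (2 * Real.pi * Complex.I * (x n : ℂ)) ^ t := by
      funext n
      have hN' : (N : ℂ) ≠ 0 := by exact_mod_cast hN0.ne'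
      rw [Pi.smul_apply, Finset.sum_apply, sum_exp_pow (hN n), Rat.smul_def]
      split_ifs
      · push_cast
        field_simp
      · simp
    rw [e]
    exact Subalgebra.smul_mem _ (sum_mem fun t _ => exp_mem_phaseAlgebra h β t) _
  obtain ⟨p, hp⟩ := hasSum_phase_real (i := i) hi
    (g := fun n => aeval (Real.cot (Real.pi * x n)) (cotPoly j) +
      (if ∃ m : ℤ, x n = m then 1 else 0) * (q - (cotPoly j).eval 0 : ℚ)) (by
    have e : (fun n => (((aeval (Real.cot (Real.pi * x n)) (cotPoly j) +
        (if ∃ m : ℤ, x n = m then 1 else 0) * (q - (cotPoly j).eval 0 : ℚ) : ℝ)) : ℂ)) =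
        (fun n => aeval ((Real.cot (Real.pi * x n) : ℝ) : ℂ) (cotPoly j)) +
        (q - (cotPoly j).eval 0 : ℚ) • fun n => if ∃ m : ℤ, x n = m then (1 : ℂ) else 0 := by
      funext n
      rw [Pi.add_apply, Pi.smul_apply, Rat.smul_def, Complex.ofReal_add]
      congr 1
      · exact (aeval_algebraMap_apply ℂ (Real.cot (Real.pi * x n)) (cotPoly j)).symm
      · split_ifs <;> simp
    rw [e]
    exact add_mem (aeval_mem_phaseAlgebra hcot _) (Subalgebra.smul_mem _ hind _))
  refine ⟨p, hasSum_of_eq (hp.mul_left (Real.pi ^ (j + 1))) (fun n => ?_) (by ring)⟩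
  rw [← mul_assoc]
  congr 1
  by_cases hn : ∃ m : ℤ, x n = m
  · rw [if_pos hn]
    obtain ⟨m, hm⟩ := hn
    have h1 : Real.cot (Real.pi * x n) = 0 := by
      rw [hm, Real.cot_eq_cos_div_sin, mul_comm, Real.sin_int_mul_pi, div_zero]
    have h2 : aeval (0 : ℝ) (cotPoly j) = (((cotPoly j).eval 0 : ℚ) : ℝ) := by
      rw [aeval_def, ← map_zero (algebraMap ℚ ℝ), eval₂_at_apply]
      rfl
    change cotSum (j + 1) (x n) = _
    rw [h1, h2, hm, hq m]
    push_cast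
    ring
  · rw [if_neg hn]
    push Not at hn
    change cotSum (j + 1) (x n) = _
    rw [cotSum_eq hn]
    ring

end TrigDirichlet

namespace TrigDirichlet

open Filter Topology

/-- Badly approximable real numbers. -/
def BadlyApproximable (τ : ℝ) : Prop :=
  ∃ c > 0, ∀ n m : ℤ, n ≠ 0 → c ≤ |(n : ℝ)| * |n * τ + m|

lemma badlyApproximable_of_quadratic {τ : ℝ} (hτ : Irrational τ) {A B C : ℤ} (hA : A ≠ 0)
    (h : (A : ℝ) * τ ^ 2 + B * τ + C = 0) : BadlyApproximable τ := by
  refine ⟨1 / (1 + |(A : ℝ)| + |2 * A * τ + B|), by positivity, fun n m hn => ?_⟩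
  have hn1 : (1 : ℝ) ≤ |(n : ℝ)| := by exact_mod_cast Int.one_le_abs hn
  have hpos : 0 < 1 + |(A : ℝ)| + |2 * A * τ + B| := by positivity
  rw [div_le_iff₀ hpos]
  have hfac : ((A * m ^ 2 - B * m * n + C * n ^ 2 : ℤ) : ℝ) =
      (n * τ + m) * (A * (n * τ + m) - n * (2 * A * τ + B)) := by
    push_cast
    linear_combination ((n : ℝ) ^ 2) * h
  have hne1 : (n : ℝ) * τ + m ≠ 0 := by
    intro h0
    exact (hτ.intCast_mul hn).add_intCast m ⟨0, by simpa using h0.symm⟩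
  have hne2 : (A : ℝ) * (n * τ + m) - n * (2 * A * τ + B) ≠ 0 := by
    intro h0
    have : Irrational ((A * n : ℤ) * τ + (B * n - A * m : ℤ)) :=
      (hτ.intCast_mul (mul_ne_zero hA hn)).add_intCast _
    apply this.ne_int 0
    push_cast
    linarith
  have hN : (1 : ℝ) ≤ |(n : ℝ) * τ + m| * |(A : ℝ) * (n * τ + m) - n * (2 * A * τ + B)| := by
    rw [← abs_mul, ← hfac]
    have : A * m ^ 2 - B * m * n + C * n ^ 2 ≠ 0 := by
      intro h0
      rw [h0, Int.cast_zero] at hfac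
      exact mul_ne_zero hne1 hne2 hfac.symm
    exact_mod_cast Int.one_le_abs this
  have hA0 := abs_nonneg (A : ℝ)
  have hD0 := abs_nonneg (2 * A * τ + B)
  rcases le_total 1 |(n : ℝ) * τ + m| with h1 | h1
  · nlinarith [mul_le_mul hn1 h1 zero_le_one (abs_nonneg (n : ℝ))]
  · have h2 : |(A : ℝ) * (n * τ + m) - n * (2 * A * τ + B)| ≤
        |(n : ℝ)| * (1 + |(A : ℝ)| + |2 * A * τ + B|) := by
      calc _ ≤ |(A : ℝ) * (n * τ + m)| + |(n : ℝ) * (2 * A * τ + B)| := abs_sub _ _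
        _ = |(A : ℝ)| * |n * τ + m| + |(n : ℝ)| * |2 * A * τ + B| := by rw [abs_mul, abs_mul]
        _ ≤ |(A : ℝ)| * 1 + |(n : ℝ)| * |2 * A * τ + B| := by gcongr
        _ ≤ _ := by nlinarith
    calc (1 : ℝ) ≤ _ := hN
      _ ≤ |(n : ℝ) * τ + m| * (|(n : ℝ)| * (1 + |(A : ℝ)| + |2 * A * τ + B|)) := by gcongr
      _ = _ := by ring

lemma BadlyApproximable.neg {τ : ℝ} (h : BadlyApproximable τ) : BadlyApproximable (-τ) := by
  obtain ⟨c, hc, h⟩ := h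
  refine ⟨c, hc, fun n m hn => ?_⟩
  have := h n (-m) hn
  rw [← abs_neg (n * τ + _)] at this
  convert this using 3
  push_cast
  ring

/-- Distance to a nearest integer. -/
noncomputable def distInt (x : ℝ) : ℝ := |x - round x|

lemma distInt_nonneg (x : ℝ) : 0 ≤ distInt x := abs_nonneg _

lemma distInt_le_half (x : ℝ) : distInt x ≤ 1 / 2 := abs_sub_round x

lemma distInt_mul_max_le (x : ℝ) (m : ℤ) :
    distInt x * max 1 |(m : ℝ)| ≤ |x - round x + m| := by
  have h0 := distInt_nonneg x
  have h1 := distInt_le_half x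
  by_cases hm : m = 0
  · subst hm
    simp [distInt]
  · have hm1 : (1 : ℝ) ≤ |(m : ℝ)| := by exact_mod_cast Int.one_le_abs hm
    rw [max_eq_right hm1]
    have h2 : |(m : ℝ)| - |x - round x| ≤ |x - round x + m| := by
      have := abs_sub_abs_le_abs_sub (m : ℝ) (-(x - round x))
      rw [abs_neg, sub_neg_eq_add, add_comm (m : ℝ)] at this
      exact this
    change |(m : ℝ)| - distInt x ≤ _ at h2
    nlinarith

lemma le_distInt {τ c : ℝ} (h : ∀ n m : ℤ, n ≠ 0 → c ≤ |(n : ℝ)| * |n * τ + m|) (l : ℕ) {n : ℤ}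
    (hn : n ≠ 0) : c / 16 ≤ |(n : ℝ)| * distInt (l / 4 + n * τ) := by
  have h1 := h (4 * n) (l - 4 * round ((l : ℝ) / 4 + n * τ)) (by omega)
  have e : ((4 * n : ℤ) : ℝ) * τ + ((l - 4 * round ((l : ℝ) / 4 + n * τ) : ℤ) : ℝ) =
      4 * ((l : ℝ) / 4 + n * τ - round ((l : ℝ) / 4 + n * τ)) := by
    push_cast
    ring
  rw [e, abs_mul] at h1
  push_cast at h1
  rw [abs_mul, abs_of_pos (by norm_num : (0 : ℝ) < 4)] at h1
  unfold distInt
  linarith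

lemma BadlyApproximable.summable_nat {τ : ℝ} (hτ : BadlyApproximable τ) (l : ℕ) {κ s : ℝ}
    (hκ : 1 < κ) (hs : κ < s) :
    Summable fun n : ℕ => ((n + 1 : ℕ) : ℝ) ^ (-s) *
      distInt (l / 4 + ((n + 1 : ℕ) : ℤ) * τ) ^ (-κ) := by
  obtain ⟨c₀, hc₀, h⟩ := hτ
  set c := c₀ / 16 with hc_def
  have hc : 0 < c := by positivity
  set ξ : ℕ → ℝ := fun n => (l : ℝ) / 4 + (n : ℤ) * τ - round ((l : ℝ) / 4 + (n : ℤ) * τ) with hξ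
  set Y : ℕ → ℝ := fun n => ξ n * 2 ^ (Nat.log 2 n + 1) / c with hY
  have hY1 : ∀ n : ℕ, n ≠ 0 → 1 ≤ |Y n| := by
    intro n hn
    have h1 := le_distInt h l (n := n) (by exact_mod_cast hn)
    have h2 : (n : ℝ) < 2 ^ (Nat.log 2 n + 1) := by
      exact_mod_cast Nat.lt_pow_succ_log_self (by norm_num) n
    rw [hY]
    simp only
    rw [abs_div, abs_mul, abs_of_pos hc, le_div_iff₀ hc, one_mul,
      abs_of_pos (by positivity : (0 : ℝ) < 2 ^ (Nat.log 2 n + 1))]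
    have h3 : |((n : ℤ) : ℝ)| = n := by simp
    rw [h3] at h1
    have h4 : (0 : ℝ) ≤ |ξ n| := abs_nonneg _
    calc c ≤ n * |ξ n| := h1
      _ ≤ 2 ^ (Nat.log 2 n + 1) * |ξ n| := by gcongr
      _ = _ := by ring
  set Φ : ℕ → ℕ × ℤ := fun n => (Nat.log 2 (n + 1), ⌊Y (n + 1)⌋) with hΦ
  have hinj : Function.Injective Φ := by
    intro n n' hnn
    rw [hΦ] at hnn
    simp only [Prod.mk.injEq] at hnn
    obtain ⟨hlog, hfl⟩ := hnn
    by_contra hne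
    have hY2 : |Y (n + 1) - Y (n' + 1)| < 1 := Int.abs_sub_lt_one_of_floor_eq_floor hfl
    set r := Nat.log 2 (n + 1) with hr
    have hYd : Y (n + 1) - Y (n' + 1) = (ξ (n + 1) - ξ (n' + 1)) * 2 ^ (r + 1) / c := by
      rw [hY]
      simp only
      rw [← hlog]
      ring
    rw [hYd, abs_div, abs_mul, abs_of_pos hc, div_lt_one hc,
      abs_of_pos (by positivity : (0 : ℝ) < 2 ^ (r + 1))] at hY2
    have hd : ((n : ℤ) - n') ≠ 0 := by omega
    have h1 := h ((n : ℤ) - n') (round ((l : ℝ) / 4 + ((n' + 1 : ℕ) : ℤ) * τ) -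
      round ((l : ℝ) / 4 + ((n + 1 : ℕ) : ℤ) * τ)) hd
    have e : ((((n : ℤ) - n' : ℤ)) : ℝ) * τ +
        ((round ((l : ℝ) / 4 + ((n' + 1 : ℕ) : ℤ) * τ) -
          round ((l : ℝ) / 4 + ((n + 1 : ℕ) : ℤ) * τ) : ℤ) : ℝ) = ξ (n + 1) - ξ (n' + 1) := by
      rw [hξ]
      push_cast
      ring
    rw [e] at h1
    have hlt : |((((n : ℤ) - n' : ℤ)) : ℝ)| ≤ 2 ^ (r + 1) := by
      have a1 : n + 1 < 2 ^ (r + 1) := Nat.lt_pow_succ_log_self (by norm_num) _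
      have a2 : n' + 1 < 2 ^ (r + 1) := by
        rw [hlog]
        exact Nat.lt_pow_succ_log_self (by norm_num) _
      have a3 : |(n : ℤ) - n'| ≤ 2 ^ (r + 1) := by
        rw [abs_le]
        zify at a1 a2
        constructor <;> omega
      exact_mod_cast a3
    have : c₀ ≤ 2 ^ (r + 1) * |ξ (n + 1) - ξ (n' + 1)| :=
      h1.trans (mul_le_mul_of_nonneg_right hlt (abs_nonneg _))
    have : c ≤ c₀ := by rw [hc_def]; linarith
    linarith
  have hq : (2 : ℝ) ^ (κ - s) < 1 := Real.rpow_lt_one_of_one_lt_of_neg (by norm_num) (by linarith)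
  have hmaj : Summable fun p : ℕ × ℤ => ((2 : ℝ) ^ (κ - s)) ^ p.1 * |(p.2 : ℝ)| ^ (-κ) :=
    (summable_geometric_of_lt_one (by positivity) hq).mul_of_nonneg
      (Real.summable_abs_int_rpow hκ) (fun _ => by positivity) (fun _ => by positivity)
  have hmaj2 := (hmaj.comp_injective hinj).mul_left (c ^ (-κ) * 4 ^ κ)
  refine Summable.of_nonneg_of_le (fun n => ?_) (fun n => ?_) hmaj2
  · exact mul_nonneg (by positivity) (Real.rpow_nonneg (distInt_nonneg _) _)
  · have hn0 : n + 1 ≠ 0 := by omega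
    set r := Nat.log 2 (n + 1) with hr
    have hYn := hY1 (n + 1) hn0
    set j := ⌊Y (n + 1)⌋ with hj
    have hj1 : (j : ℝ) ≤ Y (n + 1) := Int.floor_le _
    have hj2 : Y (n + 1) < j + 1 := Int.lt_floor_add_one _
    have hj0 : j ≠ 0 := by
      intro h0
      rw [h0] at hj1 hj2
      push_cast at hj1 hj2
      rw [abs_of_nonneg hj1] at hYn
      linarith
    have hjabs : |(j : ℝ)| ≤ 2 * |Y (n + 1)| := by
      rw [abs_le]
      have := neg_abs_le (Y (n + 1))
      have := le_abs_self (Y (n + 1))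
      constructor <;> linarith
    have hjpos : (0 : ℝ) < |(j : ℝ)| := by positivity
    have hδ : |(j : ℝ)| * c / 4 * (2 ^ r)⁻¹ ≤ distInt (l / 4 + ((n + 1 : ℕ) : ℤ) * τ) := by
      have e : |Y (n + 1)| = distInt (l / 4 + ((n + 1 : ℕ) : ℤ) * τ) * 2 ^ (r + 1) / c := by
        rw [hY]
        simp only
        rw [abs_div, abs_mul, abs_of_pos hc, ← hr,
          abs_of_pos (by positivity : (0 : ℝ) < 2 ^ (r + 1))]
        rfl
      rw [e] at hjabs
      rw [← div_eq_mul_inv, div_le_iff₀ (by positivity), div_le_iff₀ (by norm_num)]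
      calc |(j : ℝ)| * c ≤ 2 * (distInt (l / 4 + ((n + 1 : ℕ) : ℤ) * τ) * 2 ^ (r + 1) / c) * c := by
            gcongr
        _ = _ := by
          field_simp
          ring
    have hnr : (2 : ℝ) ^ r ≤ ((n + 1 : ℕ) : ℝ) := by
      exact_mod_cast Nat.pow_log_le_self 2 hn0
    have hb1 : ((n + 1 : ℕ) : ℝ) ^ (-s) ≤ ((2 : ℝ) ^ r) ^ (-s) :=
      Real.rpow_le_rpow_of_nonpos (by positivity) hnr (by linarith)
    have hb2 : distInt (l / 4 + ((n + 1 : ℕ) : ℤ) * τ) ^ (-κ) ≤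
        (|(j : ℝ)| * c / 4 * (2 ^ r)⁻¹) ^ (-κ) :=
      Real.rpow_le_rpow_of_nonpos (by positivity) hδ (by linarith)
    calc _ ≤ ((2 : ℝ) ^ r) ^ (-s) * (|(j : ℝ)| * c / 4 * (2 ^ r)⁻¹) ^ (-κ) :=
          mul_le_mul hb1 hb2 (Real.rpow_nonneg (distInt_nonneg _) _) (by positivity)
      _ = c ^ (-κ) * 4 ^ κ * (((2 : ℝ) ^ (κ - s)) ^ r * |(j : ℝ)| ^ (-κ)) := by
        rw [Real.mul_rpow (by positivity) (by positivity), Real.div_rpow (by positivity)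
          (by norm_num), Real.mul_rpow (by positivity) hc.le, Real.inv_rpow (by positivity),
          Real.rpow_neg (by norm_num : (0 : ℝ) ≤ 4), Real.rpow_neg (by positivity : (0:ℝ) ≤ 2 ^ r) κ,
          Real.rpow_sub (by norm_num), Real.rpow_neg (by positivity : (0:ℝ) ≤ 2 ^ r) s]
        have e1 : ((2 : ℝ) ^ r) ^ s = ((2 : ℝ) ^ s) ^ r := by
          rw [← Real.rpow_natCast, ← Real.rpow_natCast, ← Real.rpow_mul (by norm_num),
            ← Real.rpow_mul (by norm_num), mul_comm]
        have e2 : ((2 : ℝ) ^ r) ^ κ = ((2 : ℝ) ^ κ) ^ r := by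
          rw [← Real.rpow_natCast, ← Real.rpow_natCast, ← Real.rpow_mul (by norm_num),
            ← Real.rpow_mul (by norm_num), mul_comm]
        rw [e1, e2, div_pow]
        field_simp

/-- Convergence of the sums `∑ |n|^{-s} ‖nτ + l/4‖^{-κ}` for badly approximable `τ`. -/
lemma BadlyApproximable.summable_int {τ : ℝ} (hτ : BadlyApproximable τ) (l : ℕ) {κ s : ℝ}
    (hκ : 1 ≤ κ) (hs : κ < s) :
    Summable fun n : ℤ => |(n : ℝ)| ^ (-s) * distInt (l / 4 + n * τ) ^ (-κ) := by
  obtain ⟨κ', h1, h2⟩ := exists_between hs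
  have key : ∀ {τ : ℝ}, BadlyApproximable τ →
      Summable fun n : ℕ => |((n : ℤ) : ℝ)| ^ (-s) * distInt (l / 4 + (n : ℤ) * τ) ^ (-κ) := by
    intro τ hτ
    rw [← summable_nat_add_iff 1]
    obtain ⟨c, hc, h⟩ := id hτ
    refine Summable.of_nonneg_of_le (fun n => ?_) (fun n => ?_)
      (hτ.summable_nat l (lt_of_le_of_lt hκ h1) h2)
    · exact mul_nonneg (by positivity) (Real.rpow_nonneg (distInt_nonneg _) _)
    · have e : |(((n + 1 : ℕ) : ℤ) : ℝ)| = ((n + 1 : ℕ) : ℝ) := by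
        rw [Int.cast_natCast, Nat.abs_cast]
      rw [e]
      have hpos : 0 < distInt (l / 4 + ((n + 1 : ℕ) : ℤ) * τ) := by
        have := le_distInt h l (n := ((n + 1 : ℕ) : ℤ)) (by omega)
        rw [e] at this
        by_contra! hle
        have h0 := le_antisymm hle (distInt_nonneg _)
        rw [h0, mul_zero] at this
        linarith
      refine mul_le_mul_of_nonneg_left ?_ (by positivity)
      exact Real.rpow_le_rpow_of_exponent_ge hpos ((distInt_le_half _).trans (by norm_num))
        (by linarith)
  refine Summable.of_nat_of_neg (key hτ) ((key hτ.neg).congr fun n => ?_)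
  push_cast
  rw [abs_neg, neg_mul, mul_neg]

lemma BadlyApproximable.summable_pow {τ : ℝ} (hτ : BadlyApproximable τ) (l : ℕ) {k s : ℕ}
    (hk : k < s) (hs : 2 ≤ s) :
    Summable fun n : ℤ => |(n : ℝ)⁻¹| ^ s * (distInt (l / 4 + n * τ))⁻¹ ^ k := by
  rcases Nat.eq_zero_or_pos k with rfl | hk0
  · simp only [pow_zero, mul_one]
    refine (Real.summable_abs_int_rpow (b := s) (by exact_mod_cast hs)).congr fun n => ?_
    rw [Real.rpow_neg (abs_nonneg _), Real.rpow_natCast, abs_inv, inv_pow]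
  · refine (hτ.summable_int l (κ := k) (s := s) (by exact_mod_cast hk0)
      (by exact_mod_cast hk)).congr fun n => ?_
    rw [Real.rpow_neg (abs_nonneg _), Real.rpow_natCast, abs_inv, inv_pow,
      Real.rpow_neg (distInt_nonneg _), Real.rpow_natCast, inv_pow]

lemma abs_cot_le (x : ℝ) : |Real.cot (Real.pi * x)| ≤ (distInt x)⁻¹ := by
  rcases (distInt_nonneg x).eq_or_lt with h0 | h0
  · have : x = round x := by
      have := abs_eq_zero.1 h0.symm
      linarith
    rw [this, Real.cot_eq_cos_div_sin, mul_comm, Real.sin_int_mul_pi]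
    simp [distInt]
  · have h1 : Real.sin (Real.pi * (x - round x)) = (-1) ^ (round x) * Real.sin (Real.pi * x) := by
      rw [mul_sub, mul_comm Real.pi (round x : ℝ), Real.sin_sub_int_mul_pi]
    have h2 : 2 * distInt x ≤ |Real.sin (Real.pi * x)| := by
      have h3 : |Real.sin (Real.pi * x)| = |Real.sin (Real.pi * (x - round x))| := by
        rw [h1, abs_mul, abs_zpow, abs_neg, abs_one, one_zpow, one_mul]
      have hp := Real.pi_pos
      have h4 := Real.mul_abs_le_abs_sin (x := Real.pi * (x - round x)) (by
        rw [abs_mul, abs_of_pos hp]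
        have := distInt_le_half x
        unfold distInt at this
        nlinarith)
      rw [h3]
      refine le_trans (le_of_eq ?_) h4
      rw [abs_mul, abs_of_pos hp]
      unfold distInt
      field_simp
    rw [Real.cot_eq_cos_div_sin, abs_div]
    calc _ ≤ 1 / |Real.sin (Real.pi * x)| := by
          gcongr
          exact Real.abs_cos_le_one _
      _ ≤ 1 / distInt x := by
          gcongr
          linarith
      _ = _ := one_div _

lemma BadlyApproximable.summable_cot {τ : ℝ} (hτ : BadlyApproximable τ) (l : ℕ) {k s : ℕ}
    (hk : k < s) (hs : 2 ≤ s) :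
    Summable fun n : ℤ => Real.cot (Real.pi * (l / 4 + n * τ)) ^ k * ((n : ℝ)⁻¹) ^ s := by
  refine Summable.of_norm_bounded (hτ.summable_pow l hk hs) fun n => ?_
  rw [mul_comm, norm_mul, norm_pow, norm_pow, Real.norm_eq_abs, Real.norm_eq_abs]
  gcongr
  exact abs_cot_le _

end TrigDirichlet

namespace TrigDirichlet

open Filter Topology

section PartialFractions

lemma pow_mul_of_mul_eq {y z u : ℝ} (h : y * z = u * (z - y)) (s : ℕ) :
    y ^ s * z = u ^ s * z - ∑ j ∈ Finset.range s, u ^ (s - j) * y ^ (j + 1) := by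
  induction s with
  | zero => simp
  | succ s ih =>
    have e : ∑ j ∈ Finset.range s, u ^ (s + 1 - j) * y ^ (j + 1) =
        u * ∑ j ∈ Finset.range s, u ^ (s - j) * y ^ (j + 1) := by
      rw [Finset.mul_sum]
      refine Finset.sum_congr rfl fun j hj => ?_
      rw [show s + 1 - j = (s - j) + 1 by have := Finset.mem_range.1 hj; omega]
      ring
    rw [Finset.sum_range_succ, e]
    simp only [Nat.add_sub_cancel_left, pow_one]
    linear_combination y ^ s * h + u * ih

lemma exists_partial_fraction_aux (s k : ℕ) :
    ∃ p q : ℕ → ℤ, p 0 = 1 ∧ ∀ y z u : ℝ, y * z = u * (z - y) →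
      y ^ s * z ^ (k + 1) = ∑ i ∈ Finset.range (k + 1), p i * u ^ (s + i) * z ^ (k + 1 - i) +
        ∑ j ∈ Finset.range s, q j * u ^ (s + k - j) * y ^ (j + 1) := by
  induction k with
  | zero =>
    refine ⟨fun _ => 1, fun _ => -1, rfl, fun y z u h => ?_⟩
    have := pow_mul_of_mul_eq h s
    simp [this, sub_eq_add_neg]
  | succ k ih =>
    obtain ⟨p, q, hp, h⟩ := ih
    refine ⟨fun i => if i < k + 1 then p i else ∑ j ∈ Finset.range s, q j,
      fun l => - ∑ j ∈ Finset.range s, if l ≤ j then q j else 0, by simpa using hp,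
      fun y z u hyz => ?_⟩
    rw [pow_succ, ← mul_assoc, h y z u hyz, add_mul, Finset.sum_range_succ _ (k + 1)]
    have e1 : (∑ i ∈ Finset.range (k + 1), (p i : ℝ) * u ^ (s + i) * z ^ (k + 1 - i)) * z =
        ∑ i ∈ Finset.range (k + 1),
          ((if i < k + 1 then p i else ∑ j ∈ Finset.range s, q j : ℤ) : ℝ) * u ^ (s + i) *
            z ^ (k + 1 + 1 - i) := by
      rw [Finset.sum_mul]
      refine Finset.sum_congr rfl fun i hi => ?_
      have hi' := Finset.mem_range.1 hi
      rw [if_pos hi', show k + 1 + 1 - i = (k + 1 - i) + 1 by omega]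
      ring
    have e2 : ∀ j ∈ Finset.range s, (q j : ℝ) * u ^ (s + k - j) * y ^ (j + 1) * z =
        q j * u ^ (s + (k + 1)) * z - ∑ l ∈ Finset.range s,
          ((if l ≤ j then q j else 0 : ℤ) : ℝ) * u ^ (s + (k + 1) - l) * y ^ (l + 1) := by
      intro j hj
      have hj' := Finset.mem_range.1 hj
      have e3 : ∑ l ∈ Finset.range s,
          ((if l ≤ j then q j else 0 : ℤ) : ℝ) * u ^ (s + (k + 1) - l) * y ^ (l + 1) =
          q j * u ^ (s + k - j) * ∑ l ∈ Finset.range (j + 1), u ^ (j + 1 - l) * y ^ (l + 1) := by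
        rw [Finset.mul_sum]
        symm
        apply Finset.sum_subset_zero_on_sdiff (Finset.range_subset_range.2 (by omega))
        · intro l hl
          simp only [Finset.mem_sdiff, Finset.mem_range] at hl
          rw [if_neg (by omega)]
          simp
        · intro l hl
          have hl' := Finset.mem_range.1 hl
          rw [if_pos (by omega), show s + (k + 1) - l = (s + k - j) + (j + 1 - l) by omega, pow_add]
          ring
      rw [e3, show s + (k + 1) = (s + k - j) + (j + 1) by omega, pow_add]
      linear_combination (q j * u ^ (s + k - j)) * pow_mul_of_mul_eq hyz (j + 1)
    rw [e1, Finset.sum_mul, Finset.sum_congr rfl e2, Finset.sum_sub_distrib, Finset.sum_comm]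
    simp only [lt_irrefl, if_false, Nat.add_sub_cancel_left, pow_one]
    have e4 : ∑ j ∈ Finset.range s, (q j : ℝ) * u ^ (s + (k + 1)) * z =
        ((∑ j ∈ Finset.range s, q j : ℤ) : ℝ) * u ^ (s + (k + 1)) * z := by
      push_cast
      rw [Finset.sum_mul, Finset.sum_mul]
    have e5 : ∑ l ∈ Finset.range s, ∑ j ∈ Finset.range s,
          ((if l ≤ j then q j else 0 : ℤ) : ℝ) * u ^ (s + (k + 1) - l) * y ^ (l + 1) =
        - ∑ l ∈ Finset.range s, ((- ∑ j ∈ Finset.range s, if l ≤ j then q j else 0 : ℤ) : ℝ) *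
          u ^ (s + (k + 1) - l) * y ^ (l + 1) := by
      rw [← Finset.sum_neg_distrib]
      refine Finset.sum_congr rfl fun l _ => ?_
      push_cast
      rw [neg_mul, neg_mul, neg_neg, Finset.sum_mul, Finset.sum_mul]
    rw [e4, e5]
    ring

/-- Partial fraction decomposition of `1 / (Y ^ s Z ^ k)` with respect to `U = Y - Z`, written in
terms of the inverses `y, z, u`. If `k = 1`, the pole of order one in `U` is moved to the left. -/
lemma exists_partial_fraction {s k : ℕ} (hs : 1 ≤ s) (hk : 1 ≤ k) :
    ∃ p q : ℕ → ℤ, p 0 = 1 ∧ ∀ y z u : ℝ, y * z = u * (z - y) →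
      y ^ s * z ^ k + (if k = 1 then y ^ s * u else 0) =
        ∑ i ∈ Finset.range k, p i * u ^ (s + i) * z ^ (k - i) +
        ∑ j ∈ Finset.range (s + k - 2), q j * u ^ (s + k - 1 - j) * y ^ (j + 1) := by
  rcases hk.eq_or_lt with rfl | hk2
  · refine ⟨fun _ => 1, fun _ => -1, rfl, fun y z u h => ?_⟩
    obtain ⟨t, rfl⟩ : ∃ t, s = t + 1 := ⟨s - 1, by omega⟩
    have := pow_mul_of_mul_eq h (t + 1)
    rw [Finset.sum_range_succ] at this
    simp only [if_true, pow_one, this]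
    simp
    ring
  · obtain ⟨l, rfl⟩ : ∃ l, k = l + 1 := ⟨k - 1, by omega⟩
    obtain ⟨p, q, hp, h⟩ := exists_partial_fraction_aux s l
    refine ⟨p, fun j => if j < s then q j else 0, hp, fun y z u hyz => ?_⟩
    rw [if_neg (by omega), add_zero, h y z u hyz]
    congr 1
    apply Finset.sum_subset_zero_on_sdiff (Finset.range_subset_range.2 (by omega))
    · intro j hj
      simp only [Finset.mem_sdiff, Finset.mem_range] at hj
      simp only [if_neg hj.2]
      simp
    · intro j hj
      simp only [if_pos (Finset.mem_range.1 hj)]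
      congr 2

end PartialFractions

/-- An integral matrix `(d, c; b, a)` of determinant one with `c = 4 c₀ ≠ 0`, `a = 1 + 4 a₀`. -/
structure CongruenceMatrix where
  a₀ : ℤ
  b : ℤ
  c₀ : ℤ
  d : ℤ
  det : (1 + 4 * a₀) * d - b * (4 * c₀) = 1
  c₀_ne_zero : c₀ ≠ 0

namespace CongruenceMatrix

variable (M : CongruenceMatrix)

/-- The upper left entry, as a real number. -/
noncomputable def a : ℝ := 1 + 4 * M.a₀

/-- The lower left entry, as a real number. -/
noncomputable def c : ℝ := 4 * M.c₀

lemma c_ne_zero : M.c ≠ 0 := by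
  have := M.c₀_ne_zero
  unfold c
  positivity

lemma det_real : M.a * M.d - M.b * M.c = 1 := by
  unfold a c
  exact_mod_cast M.det

/-- The matrix fixes the real number `τ`. -/
def Fixes (τ : ℝ) : Prop := M.c * τ ^ 2 + (M.a - M.d) * τ - M.b = 0

/-- The action on the shifted lattice `ℤ × (ℤ + l / 4)`. -/
def act (l : ℕ) : ℤ × ℤ ≃ ℤ × ℤ where
  toFun v := (4 * M.c₀ * v.2 + M.c₀ * l + M.d * v.1, (1 + 4 * M.a₀) * v.2 + M.a₀ * l + M.b * v.1)
  invFun v := ((1 + 4 * M.a₀) * v.1 - 4 * M.c₀ * v.2 - M.c₀ * l,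
    -M.b * v.1 + M.d * v.2 + (M.b * M.c₀ - M.a₀ * M.d) * l)
  left_inv v := by
    ext
    · simp only
      linear_combination v.1 * M.det
    · simp only
      linear_combination v.2 * M.det
  right_inv v := by
    ext
    · simp only
      linear_combination (v.1 - M.c₀ * l) * M.det
    · simp only
      linear_combination (v.2 - M.a₀ * l) * M.det

end CongruenceMatrix

lemma summable_max_rpow {κ : ℝ} (hκ : 1 < κ) :
    Summable fun m : ℤ => (max 1 |(m : ℝ)|) ^ (-κ) := by
  have h := ((Real.summable_one_div_int_add_rpow (1 / 2) κ).2 hκ).mul_left ((3 / 2 : ℝ) ^ κ)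
  refine Summable.of_nonneg_of_le (fun m => by positivity) (fun m => ?_) h
  have h0 : (0 : ℝ) < |(m : ℝ) + 1 / 2| := by
    rw [abs_pos]
    intro h0
    have : (2 * m + 1 : ℤ) = 0 := by
      have : ((2 * m + 1 : ℤ) : ℝ) = 0 := by push_cast; linarith
      exact_mod_cast this
    omega
  have h1 : |(m : ℝ) + 1 / 2| ≤ 3 / 2 * max 1 |(m : ℝ)| := by
    have := abs_add_le (m : ℝ) (1 / 2)
    rw [abs_of_pos (by norm_num : (0 : ℝ) < 1 / 2)] at this
    have := le_max_left 1 |(m : ℝ)|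
    have := le_max_right 1 |(m : ℝ)|
    linarith
  have h2 : (max 1 |(m : ℝ)|) ^ (-κ) ≤ (|(m : ℝ) + 1 / 2| / (3 / 2)) ^ (-κ) :=
    Real.rpow_le_rpow_of_nonpos (by positivity) (by rw [div_le_iff₀ (by norm_num)]; linarith)
      (by linarith)
  refine h2.trans (le_of_eq ?_)
  rw [Real.div_rpow (by positivity) (by norm_num), Real.rpow_neg (by norm_num),
    Real.rpow_neg (by positivity)]
  field_simp

lemma summable_max_pow {k : ℕ} (hk : 2 ≤ k) : Summable fun m : ℤ => (max 1 |(m : ℝ)|)⁻¹ ^ k := by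
  refine (summable_max_rpow (κ := k) (by exact_mod_cast hk)).congr fun m => ?_
  rw [Real.rpow_neg (by positivity), Real.rpow_natCast, inv_pow]

lemma inv_mul_inv_sqrt_eq {t : ℝ} (ht : 0 ≤ t) : t⁻¹ * (√t)⁻¹ = t ^ (-(3 / 2) : ℝ) := by
  rw [Real.sqrt_eq_rpow, ← Real.rpow_neg_one, ← Real.rpow_neg ht]
  rcases ht.eq_or_lt with rfl | ht
  · norm_num
  · rw [← Real.rpow_add ht]
    norm_num

lemma summable_max_inv_sqrt :
    Summable fun m : ℤ => (max 1 |(m : ℝ)|)⁻¹ * (√(max 1 |(m : ℝ)|))⁻¹ :=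
  (summable_max_rpow (κ := 3 / 2) (by norm_num)).congr fun m =>
    (inv_mul_inv_sqrt_eq (by positivity)).symm

lemma summable_abs_inv_sqrt :
    Summable fun m : ℤ => |(m : ℝ)|⁻¹ * (√|(m : ℝ)|)⁻¹ :=
  (Real.summable_abs_int_rpow (b := 3 / 2) (by norm_num)).congr fun m =>
    (inv_mul_inv_sqrt_eq (by positivity)).symm

/-- Translating the second coordinate by an amount depending on the first one. -/
def shear (r : ℤ → ℤ) : ℤ × ℤ ≃ ℤ × ℤ where
  toFun v := (v.1, v.2 + r v.1)
  invFun v := (v.1, v.2 - r v.1)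
  left_inv v := by simp
  right_inv v := by simp

end TrigDirichlet

namespace TrigDirichlet

open Filter Topology

lemma BadlyApproximable.distInt_pos {τ : ℝ} (hτ : BadlyApproximable τ) (l : ℕ) {n : ℤ}
    (hn : n ≠ 0) : 0 < distInt (l / 4 + n * τ) := by
  obtain ⟨c, hc, h⟩ := hτ
  have h1 := le_distInt h l hn
  by_contra! hle
  rw [le_antisymm hle (distInt_nonneg _), mul_zero] at h1
  linarith

lemma abs_inv_add_le {x : ℝ} (hx : 0 < distInt x) (m : ℤ) :
    |(x + m)⁻¹| ≤ (distInt x)⁻¹ * (max 1 |((m + round x : ℤ) : ℝ)|)⁻¹ := by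
  have h := distInt_mul_max_le x (m + round x)
  have e : x - round x + ((m + round x : ℤ) : ℝ) = x + m := by
    push_cast
    ring
  rw [e] at h
  rw [abs_inv, ← mul_inv]
  exact inv_anti₀ (by positivity) h

/-- The summand of the double series, in terms of the inverses of three linear forms. -/
noncomputable def coneTerm (s k : ℕ) (y z u : ℝ) : ℝ :=
  y ^ s * z ^ k + if k = 1 then y ^ s * u else 0

lemma coneTerm_zero {s k : ℕ} (hs : 1 ≤ s) (z u : ℝ) : coneTerm s k 0 z u = 0 := by
  unfold coneTerm
  rw [zero_pow (by omega)]
  simp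

lemma summable_coneTerm_of_two_le {τ : ℝ} (hτ : BadlyApproximable τ) (l : ℕ) (E : ℝ)
    {s k : ℕ} (hk : 2 ≤ k) (hs : k < s) (u : ℤ × ℤ → ℝ) :
    Summable fun p : ℤ × ℤ =>
      coneTerm s k (p.1 : ℝ)⁻¹ (E * ((l : ℝ) / 4 + p.1 * τ + p.2)⁻¹) (u p) := by
  have h1 := (hτ.summable_pow l hs (by omega)).mul_of_nonneg (summable_max_pow hk)
    (fun n => mul_nonneg (by positivity) (pow_nonneg (inv_nonneg.2 (distInt_nonneg _)) _))
    (fun _ => by positivity)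
  have h2 := ((shear fun n => round ((l : ℝ) / 4 + n * τ)).summable_iff.2 h1).mul_left (|E| ^ k)
  refine Summable.of_norm_bounded h2 fun p => ?_
  by_cases hn : p.1 = 0
  · rw [hn, Int.cast_zero, inv_zero, coneTerm_zero (by omega), norm_zero]
    simp only [shear, Function.comp, Equiv.coe_fn_mk]
    have := distInt_nonneg ((l : ℝ) / 4 + p.1 * τ)
    positivity
  · have hδ := hτ.distInt_pos l hn
    have h3 := abs_inv_add_le hδ p.2
    unfold coneTerm
    rw [if_neg (by omega), add_zero, norm_mul, norm_pow, norm_pow, Real.norm_eq_abs,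
      Real.norm_eq_abs, abs_mul, mul_pow]
    simp only [shear, Function.comp, Equiv.coe_fn_mk]
    calc _ ≤ |(p.1 : ℝ)⁻¹| ^ s * (|E| ^ k * ((distInt ((l : ℝ) / 4 + p.1 * τ))⁻¹ *
          (max 1 |((p.2 + round ((l : ℝ) / 4 + p.1 * τ) : ℤ) : ℝ)|)⁻¹) ^ k) := by gcongr
      _ = _ := by
        rw [mul_pow]
        ring

/-- Two real numbers of which a linear combination is large cannot both be small. -/
lemma inv_mul_inv_le {L Z N D δ w : ℝ} (hL : 1 ≤ L) (hD : 0 < D) (hN : 1 ≤ N)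
    (hδ : 0 < δ) (hδ1 : δ ≤ 1 / 2) (hw : 1 ≤ w) (hZw : δ * w ≤ Z) (hwZ : w = 1 ∨ w ≤ 2 * Z)
    (h : N ≤ D * max Z L) :
    N⁻¹ * (Z⁻¹ * L⁻¹) ≤ 2 * √D * ((N⁻¹ * (√N)⁻¹) * (L⁻¹ * (√L)⁻¹) +
      ((N⁻¹ * (√N)⁻¹) * δ⁻¹) * (w⁻¹ * (√w)⁻¹)) := by
  have hZ : 0 < Z := lt_of_lt_of_le (by positivity) hZw
  have hL0 : 0 < L := by linarith
  have hN0 : 0 < N := by linarith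
  have hw0 : 0 < w := by linarith
  have sN := Real.sqrt_pos.2 hN0
  have sL := Real.sqrt_pos.2 hL0
  have sZ := Real.sqrt_pos.2 hZ
  have sw := Real.sqrt_pos.2 hw0
  have sD := Real.sqrt_pos.2 hD
  have hA : 0 ≤ (N⁻¹ * (√N)⁻¹) * (L⁻¹ * (√L)⁻¹) := by positivity
  have hB : 0 ≤ ((N⁻¹ * (√N)⁻¹) * δ⁻¹) * (w⁻¹ * (√w)⁻¹) := by positivity
  rcases le_total L Z with hLZ | hZL
  · rw [max_eq_left hLZ] at h
    have h1 : √N ≤ √D * √Z := by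
      rw [← Real.sqrt_mul hD.le]
      exact Real.sqrt_le_sqrt h
    have h2 : (√Z)⁻¹ ≤ √D * (√N)⁻¹ := by
      rw [inv_le_iff_one_le_mul₀ sZ, mul_assoc, mul_comm, mul_assoc, ← div_eq_inv_mul,
        le_div_iff₀ sN]
      linarith
    have h3 : (√Z)⁻¹ ≤ (√L)⁻¹ := inv_anti₀ sL (Real.sqrt_le_sqrt hLZ)
    have h4 : Z⁻¹ = (√Z)⁻¹ * (√Z)⁻¹ := by rw [← mul_inv, Real.mul_self_sqrt hZ.le]
    calc N⁻¹ * (Z⁻¹ * L⁻¹) = N⁻¹ * ((√Z)⁻¹ * (√Z)⁻¹ * L⁻¹) := by rw [h4]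
      _ ≤ N⁻¹ * ((√D * (√N)⁻¹) * (√L)⁻¹ * L⁻¹) := by gcongr
      _ = √D * ((N⁻¹ * (√N)⁻¹) * (L⁻¹ * (√L)⁻¹)) := by ring
      _ ≤ _ := by nlinarith [mul_nonneg sD.le hA, mul_nonneg sD.le hB]
  · rw [max_eq_right hZL] at h
    have hwL : w ≤ 2 * L := by
      rcases hwZ with h1 | h1
      · linarith
      · linarith
    have hsq : √L * √L = L := Real.mul_self_sqrt hL0.le
    have h1 : √N ≤ √D * √L := by
      rw [← Real.sqrt_mul hD.le]
      exact Real.sqrt_le_sqrt h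
    have h2 : √w ≤ 2 * √L := by
      rw [Real.sqrt_le_left (by positivity)]
      nlinarith
    have h3 : √N * √w ≤ 2 * √D * L := by
      calc √N * √w ≤ (√D * √L) * (2 * √L) := by gcongr
        _ = 2 * √D * (√L * √L) := by ring
        _ = _ := by rw [hsq]
    have h4 : L⁻¹ ≤ 2 * √D * ((√N)⁻¹ * (√w)⁻¹) := by
      rw [← mul_inv, ← div_eq_mul_inv, le_div_iff₀ (by positivity), inv_mul_le_iff₀ hL0]
      linarith
    have h5 : Z⁻¹ ≤ δ⁻¹ * w⁻¹ := by
      rw [← mul_inv]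
      exact inv_anti₀ (by positivity) hZw
    calc N⁻¹ * (Z⁻¹ * L⁻¹) ≤ N⁻¹ * ((δ⁻¹ * w⁻¹) * (2 * √D * ((√N)⁻¹ * (√w)⁻¹))) := by gcongr
      _ = 2 * √D * (((N⁻¹ * (√N)⁻¹) * δ⁻¹) * (w⁻¹ * (√w)⁻¹)) := by ring
      _ ≤ _ := by nlinarith [mul_nonneg sD.le hA, mul_nonneg sD.le hB]

namespace CongruenceMatrix

variable (M : CongruenceMatrix) (l : ℕ)

/-- The first coordinate of the preimage of a lattice point. -/
def preFst (p : ℤ × ℤ) : ℤ := (1 + 4 * M.a₀) * p.1 - 4 * M.c₀ * p.2 - M.c₀ * l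

lemma preFst_real (p : ℤ × ℤ) : (M.preFst l p : ℝ) = M.a * p.1 - M.c * (p.2 + l / 4) := by
  unfold preFst a c
  push_cast
  ring

lemma summable_preFst : Summable fun p : ℤ × ℤ => (|(p.1 : ℝ)|⁻¹ * (√|(p.1 : ℝ)|)⁻¹) *
    ((max 1 |(M.preFst l p : ℝ)|)⁻¹ * (√(max 1 |(M.preFst l p : ℝ)|))⁻¹) := by
  have h := summable_abs_inv_sqrt.mul_of_nonneg summable_max_inv_sqrt (fun _ => by positivity)
    (fun _ => by positivity)
  have hinj : Function.Injective fun p : ℤ × ℤ => (p.1, M.preFst l p) := by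
    rintro ⟨n, m⟩ ⟨n', m'⟩ h
    simp only [Prod.mk.injEq, preFst] at h
    obtain ⟨rfl, h⟩ := h
    have h1 : M.c₀ * (m - m') = 0 := by linarith
    rcases mul_eq_zero.1 h1 with h2 | h2
    · exact absurd h2 M.c₀_ne_zero
    · rw [sub_eq_zero.1 h2]
  have h2 := h.comp_injective hinj
  simpa only [Function.comp_def] using h2

lemma summable_coneTerm_one {τ : ℝ} (hτ : BadlyApproximable τ)
    (hE : M.c * τ + M.a ≠ 0) {s : ℕ} (hs : 2 ≤ s) :
    Summable fun p : ℤ × ℤ => coneTerm s 1 (p.1 : ℝ)⁻¹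
      ((M.c * τ + M.a) / M.c * ((l : ℝ) / 4 + p.1 * τ + p.2)⁻¹)
      ((M.c * τ + M.a) * (M.preFst l p : ℝ)⁻¹) := by
  set E := M.c * τ + M.a with hE_def
  have hc := M.c_ne_zero
  have hE0 : 0 < |E| := abs_pos.2 hE
  have hc0 : 0 < |M.c| := abs_pos.2 hc
  set D : ℝ := (|M.c| + 1) / |E| with hD_def
  have hD : 0 < D := by positivity
  have h1 := M.summable_preFst l
  have h2a : Summable fun n : ℤ => (|(n : ℝ)|⁻¹ * (√|(n : ℝ)|)⁻¹) *
      (distInt ((l : ℝ) / 4 + n * τ))⁻¹ := by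
    refine (hτ.summable_int l (κ := 1) (s := 3 / 2) le_rfl (by norm_num)).congr fun n => ?_
    rw [inv_mul_inv_sqrt_eq (abs_nonneg _), Real.rpow_neg_one]
  have h2b := h2a.mul_of_nonneg summable_max_inv_sqrt
    (fun n => mul_nonneg (by positivity) (inv_nonneg.2 (distInt_nonneg _)))
    (fun _ => by positivity)
  have h2 := (shear fun n => round ((l : ℝ) / 4 + n * τ)).summable_iff.2 h2b
  have h3 := ((h1.add h2).mul_left (E ^ 2 / |M.c| * (2 * √D))).add h1
  refine Summable.of_norm_bounded h3 fun p => ?_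
  have hw1 : ∀ m : ℤ, (1 : ℝ) ≤ max 1 |(m : ℝ)| := fun m => le_max_left _ _
  by_cases hn : p.1 = 0
  · rw [hn, Int.cast_zero, inv_zero, coneTerm_zero (by omega), norm_zero]
    simp only [shear, Function.comp, Equiv.coe_fn_mk]
    have := distInt_nonneg ((l : ℝ) / 4 + p.1 * τ)
    positivity
  have hδ := hτ.distInt_pos l hn
  simp only [shear, Function.comp, Equiv.coe_fn_mk]
  set x := (l : ℝ) / 4 + p.1 * τ with hx
  have hN : (1 : ℝ) ≤ |(p.1 : ℝ)| := by exact_mod_cast Int.one_le_abs hn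
  have hn' : (p.1 : ℝ) ≠ 0 := by exact_mod_cast hn
  have hrel : M.c * (x + p.2) + M.preFst l p = E * p.1 := by
    rw [preFst_real, hx, hE_def]
    ring
  have hZ0 : 0 < |x + p.2| := by
    have h := distInt_mul_max_le x (p.2 + round x)
    have e : x - round x + ((p.2 + round x : ℤ) : ℝ) = x + p.2 := by
      push_cast
      ring
    rw [e] at h
    refine lt_of_lt_of_le ?_ h
    have := hw1 (p.2 + round x)
    positivity
  have hZ : x + p.2 ≠ 0 := abs_pos.1 hZ0
  have hyle : |(p.1 : ℝ)|⁻¹ ≤ 1 := inv_le_one_of_one_le₀ hN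
  by_cases hL : M.preFst l p = 0
  · have hz : E / M.c * (x + p.2)⁻¹ = (p.1 : ℝ)⁻¹ := by
      rw [hL, Int.cast_zero, add_zero] at hrel
      field_simp
      linarith
    rw [hz, hL]
    unfold coneTerm
    simp only [if_true, Int.cast_zero, inv_zero, mul_zero, add_zero, pow_one, abs_zero,
      max_eq_left zero_le_one, Real.sqrt_one, inv_one, mul_one]
    have h4 : ‖(p.1 : ℝ)⁻¹ ^ s * (p.1 : ℝ)⁻¹‖ ≤ |(p.1 : ℝ)|⁻¹ * (√|(p.1 : ℝ)|)⁻¹ := by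
      rw [norm_mul, norm_pow, Real.norm_eq_abs, abs_inv, mul_comm]
      have h5 : √|(p.1 : ℝ)| ≤ |(p.1 : ℝ)| := by
        rw [Real.sqrt_le_left (by positivity)]
        nlinarith
      have h6 : |(p.1 : ℝ)|⁻¹ ^ s ≤ |(p.1 : ℝ)|⁻¹ ^ 1 :=
        pow_le_pow_of_le_one (by positivity) hyle (by omega)
      rw [pow_one] at h6
      have h7 : |(p.1 : ℝ)|⁻¹ ≤ (√|(p.1 : ℝ)|)⁻¹ := inv_anti₀ (by positivity) h5
      gcongr
      exact h6.trans h7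
    refine h4.trans (le_add_of_nonneg_left ?_)
    have := hw1 (p.2 + round x)
    positivity
  · have hL1 : (1 : ℝ) ≤ |(M.preFst l p : ℝ)| := by exact_mod_cast Int.one_le_abs hL
    have hL' : (M.preFst l p : ℝ) ≠ 0 := by exact_mod_cast hL
    have hmaxL : max 1 |(M.preFst l p : ℝ)| = |(M.preFst l p : ℝ)| := max_eq_right hL1
    rw [hmaxL]
    have hcone : coneTerm s 1 (p.1 : ℝ)⁻¹ (E / M.c * (x + p.2)⁻¹) (E * (M.preFst l p : ℝ)⁻¹) =
        (p.1 : ℝ)⁻¹ ^ (s - 1) * (E ^ 2 / M.c) * ((x + p.2)⁻¹ * (M.preFst l p : ℝ)⁻¹) := by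
      unfold coneTerm
      obtain ⟨t, rfl⟩ : ∃ t, s = t + 1 := ⟨s - 1, by omega⟩
      rw [if_pos rfl, Nat.add_sub_cancel, pow_succ]
      have h6 : E / M.c * (x + p.2)⁻¹ + E * (M.preFst l p : ℝ)⁻¹ =
          p.1 * (E ^ 2 / M.c) * ((x + p.2)⁻¹ * (M.preFst l p : ℝ)⁻¹) := by
        field_simp
        linear_combination hrel
      have h7 : (p.1 : ℝ)⁻¹ * p.1 = 1 := inv_mul_cancel₀ hn'
      linear_combination ((p.1 : ℝ)⁻¹ ^ t * (p.1 : ℝ)⁻¹) * h6 +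
        ((p.1 : ℝ)⁻¹ ^ t * (E ^ 2 / M.c) * ((x + p.2)⁻¹ * (M.preFst l p : ℝ)⁻¹)) * h7
    have hpow : |(p.1 : ℝ)|⁻¹ ^ (s - 1) ≤ |(p.1 : ℝ)|⁻¹ := by
      have := pow_le_pow_of_le_one (by positivity) hyle (show 1 ≤ s - 1 by omega)
      rwa [pow_one] at this
    have hmain := inv_mul_inv_le (L := |(M.preFst l p : ℝ)|) (Z := |x + p.2|)
      (N := |(p.1 : ℝ)|) (D := D) (δ := distInt x)
      (w := max 1 |((p.2 + round x : ℤ) : ℝ)|) hL1 hD hN hδ (distInt_le_half x) (hw1 _)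
      (by
        have h := distInt_mul_max_le x (p.2 + round x)
        have e : x - round x + ((p.2 + round x : ℤ) : ℝ) = x + p.2 := by
          push_cast
          ring
        rwa [e] at h)
      (by
        rcases eq_or_ne (p.2 + round x) 0 with h0 | h0
        · left
          rw [h0]
          simp
        · right
          have hm1 : (1 : ℝ) ≤ |((p.2 + round x : ℤ) : ℝ)| := by
            exact_mod_cast Int.one_le_abs h0
          rw [max_eq_right hm1]
          have h1 := abs_sub_round x
          have h2 := abs_sub_abs_le_abs_sub ((p.2 + round x : ℤ) : ℝ) (-(x - round x))
          rw [abs_neg] at h2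
          have e : ((p.2 + round x : ℤ) : ℝ) - -(x - round x) = x + p.2 := by
            push_cast
            ring
          rw [e] at h2
          linarith)
      (by
        have h1 : |E| * |(p.1 : ℝ)| ≤ |M.c| * |x + p.2| + |(M.preFst l p : ℝ)| := by
          rw [← abs_mul, ← hrel, ← abs_mul]
          exact abs_add_le _ _
        have h2 := le_max_left |x + p.2| |(M.preFst l p : ℝ)|
        have h3 := le_max_right |x + p.2| |(M.preFst l p : ℝ)|
        rw [hD_def, div_mul_eq_mul_div, le_div_iff₀ hE0]
        nlinarith)
    rw [hcone]
    refine le_trans ?_ (le_add_of_nonneg_right (by positivity))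
    rw [norm_mul, norm_mul, norm_mul, norm_pow, norm_div, Real.norm_eq_abs, Real.norm_eq_abs,
      Real.norm_eq_abs, Real.norm_eq_abs, Real.norm_eq_abs, abs_inv, abs_inv, abs_inv,
      abs_of_nonneg (sq_nonneg E)]
    calc _ ≤ |(p.1 : ℝ)|⁻¹ * (E ^ 2 / |M.c|) * (|x + p.2|⁻¹ * |(M.preFst l p : ℝ)|⁻¹) := by
          gcongr
      _ = E ^ 2 / |M.c| * (|(p.1 : ℝ)|⁻¹ * (|x + p.2|⁻¹ * |(M.preFst l p : ℝ)|⁻¹)) := by ring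
      _ ≤ _ := by
          rw [mul_assoc (E ^ 2 / |M.c|)]
          exact mul_le_mul_of_nonneg_left hmain (by positivity)

end CongruenceMatrix

end TrigDirichlet

namespace TrigDirichlet

open Filter Topology SummationFilter Polynomial

lemma hasSum_cotSum_of_two_le {k : ℕ} (hk : 2 ≤ k) (x : ℝ) :
    HasSum (fun m : ℤ => ((x + m)⁻¹) ^ k) (cotSum k x) := by
  have hs : Summable fun m : ℤ => ((x + m)⁻¹) ^ k :=
    Summable.of_abs ((summable_inv_add_int_pow x hk).congr fun m => (abs_pow _ _).symm)
  rw [(hasSum_cotSum (by omega) x).unique (hasSum_symmetricIcc_of_hasSum hs.hasSum)]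
  exact hs.hasSum

/-- The double series `∑_{n ≠ 0} n^{-i} ∑_m (l / 4 + n x + m)^{-k}`. -/
noncomputable def cotSeries (l k i : ℕ) (x : ℝ) : ℝ :=
  ∑' n : ℤ, cotSum k ((l : ℝ) / 4 + n * x) * ((n : ℝ)⁻¹) ^ i

lemma ne_int_of_irrational {τ : ℝ} (hτ : Irrational τ) (l : ℕ) {n : ℤ} (hn : n ≠ 0) (m : ℤ) :
    (l : ℝ) / 4 + n * τ ≠ m := by
  have h := ((hτ.intCast_mul hn).ratCast_add ((l : ℚ) / 4)).ne_int m
  push_cast at h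
  exact h

lemma summable_cotSum {τ : ℝ} (hirr : Irrational τ) (hτ : BadlyApproximable τ) (l : ℕ) {k s : ℕ}
    (hk : 1 ≤ k) (hs : k < s) :
    Summable fun n : ℤ => cotSum k ((l : ℝ) / 4 + n * τ) * ((n : ℝ)⁻¹) ^ s := by
  obtain ⟨j, rfl⟩ : ∃ j, k = j + 1 := ⟨k - 1, by omega⟩
  have h : Summable fun n : ℤ => ∑ i ∈ Finset.range (j + 2), (Real.pi ^ (j + 1) *
      ((cotPoly j).coeff i : ℝ)) * (Real.cot (Real.pi * (l / 4 + n * τ)) ^ i * ((n : ℝ)⁻¹) ^ s) := by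
    refine summable_sum fun i hi => ?_
    have := Finset.mem_range.1 hi
    exact (hτ.summable_cot l (by omega) (by omega)).mul_left _
  refine h.congr fun n => ?_
  rcases eq_or_ne n 0 with rfl | hn
  · have h0 : (((0 : ℤ) : ℝ)⁻¹) ^ s = 0 := by
      rw [Int.cast_zero, inv_zero, zero_pow (by omega)]
    simp only [h0, mul_zero, Finset.sum_const_zero]
  · rw [cotSum_eq (ne_int_of_irrational hirr l hn), aeval_eq_sum_range'
      (lt_of_le_of_lt (natDegree_cotPoly_le j) (Nat.lt_succ_self _)), Finset.mul_sum,
      Finset.sum_mul]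
    refine Finset.sum_congr rfl fun i _ => ?_
    rw [Rat.smul_def]
    ring

lemma hasSum_axis {φ : ℤ → ℝ} {a : ℝ} (h : HasSum φ a) :
    HasSum (fun p : ℤ × ℤ => if p.1 = 0 then φ p.2 else 0) a := by
  have hinj : Function.Injective fun m : ℤ => ((0 : ℤ), m) := fun a b hab => by simpa using hab
  rw [← hinj.hasSum_iff]
  · simpa [Function.comp_def] using h
  · rintro ⟨n, m⟩ hnm
    have : n ≠ 0 := by
      rintro rfl
      exact hnm ⟨m, rfl⟩
    simp [this]

lemma coneTerm_eq {s k : ℕ} (hk : 1 ≤ k) (hs : k < s) {p q : ℕ → ℤ}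
    (hpq : ∀ y z u : ℝ, y * z = u * (z - y) →
      y ^ s * z ^ k + (if k = 1 then y ^ s * u else 0) =
        ∑ i ∈ Finset.range k, p i * u ^ (s + i) * z ^ (k - i) +
        ∑ j ∈ Finset.range (s + k - 2), q j * u ^ (s + k - 1 - j) * y ^ (j + 1))
    {Y Z U : ℝ} (h : Y = Z + U) (hZ : Z = 0 → U = 0) :
    ∑ i ∈ Finset.range k, p i * U⁻¹ ^ (s + i) * Z⁻¹ ^ (k - i) +
      ∑ j ∈ Finset.range (s + k - 2), q j * U⁻¹ ^ (s + k - 1 - j) * Y⁻¹ ^ (j + 1) =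
    coneTerm s k Y⁻¹ Z⁻¹ U⁻¹ - (if U = 0 then Y⁻¹ ^ (s + k) else 0) +
      if Y = 0 then (∑ i ∈ Finset.range k, (p i : ℝ) * (-1) ^ (k - i)) * U⁻¹ ^ (s + k) else 0 := by
  by_cases hU : U = 0
  · have e1 : ∀ i ∈ Finset.range k, (p i : ℝ) * U⁻¹ ^ (s + i) * Z⁻¹ ^ (k - i) = 0 := by
      intro i _
      rw [hU, inv_zero, zero_pow (by omega)]
      ring
    have e2 : ∀ j ∈ Finset.range (s + k - 2),
        (q j : ℝ) * U⁻¹ ^ (s + k - 1 - j) * Y⁻¹ ^ (j + 1) = 0 := by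
      intro j hj
      have := Finset.mem_range.1 hj
      rw [hU, inv_zero, zero_pow (by omega)]
      ring
    have hYZ : Z = Y := by rw [h, hU, add_zero]
    rw [Finset.sum_congr rfl e1, Finset.sum_congr rfl e2, hYZ, hU, if_pos rfl, inv_zero,
      zero_pow (by omega : s + k ≠ 0)]
    unfold coneTerm
    simp [pow_add]
  · have hZ0 : Z ≠ 0 := fun h0 => hU (hZ h0)
    rw [if_neg hU, sub_zero]
    by_cases hY : Y = 0
    · have e2 : ∀ j ∈ Finset.range (s + k - 2),
          (q j : ℝ) * U⁻¹ ^ (s + k - 1 - j) * Y⁻¹ ^ (j + 1) = 0 := by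
        intro j _
        rw [hY, inv_zero, zero_pow (by omega)]
        ring
      have e1 : ∀ i ∈ Finset.range k, (p i : ℝ) * U⁻¹ ^ (s + i) * Z⁻¹ ^ (k - i) =
          p i * (-1) ^ (k - i) * U⁻¹ ^ (s + k) := by
        intro i hi
        have := Finset.mem_range.1 hi
        have hZU : Z⁻¹ = (-1) * U⁻¹ := by
          rw [show Z = -U by linarith, inv_neg]
          ring
        rw [hZU, mul_pow, show s + k = (s + i) + (k - i) by omega, pow_add U⁻¹ (s + i)]
        ring
      rw [Finset.sum_congr rfl e1, Finset.sum_congr rfl e2, Finset.sum_const_zero, add_zero,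
        if_pos hY, hY, inv_zero, coneTerm_zero (by omega), zero_add, Finset.sum_mul]
    · rw [if_neg hY, add_zero]
      refine (hpq _ _ _ ?_).symm
      field_simp
      linarith

namespace CongruenceMatrix

variable (M : CongruenceMatrix)

lemma Fixes.mul_eq {M : CongruenceMatrix} {τ : ℝ} (h : M.Fixes τ) :
    (M.c * τ + M.a) * (M.d - M.c * τ) = 1 := by
  unfold Fixes at h
  linear_combination M.det_real - M.c * h

lemma act_fst (l : ℕ) (v : ℤ × ℤ) :
    (((M.act l v).1 : ℤ) : ℝ) = M.c * (l / 4 + v.1 * (M.d / M.c) + v.2) := by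
  have hc := M.c_ne_zero
  have : (((M.act l v).1 : ℤ) : ℝ) = M.c * (v.2 + l / 4) + M.d * v.1 := by
    simp only [act, Equiv.coe_fn_mk, c]
    push_cast
    ring
  rw [this]
  field_simp
  ring

lemma act_snd (l : ℕ) (v : ℤ × ℤ) :
    (((M.act l v).2 : ℤ) : ℝ) = M.a * (v.2 + l / 4) + M.b * v.1 - l / 4 := by
  simp only [act, Equiv.coe_fn_mk, a]
  push_cast
  ring

lemma preFst_act (l : ℕ) (v : ℤ × ℤ) : M.preFst l (M.act l v) = v.1 :=
  congrArg Prod.fst ((M.act l).symm_apply_apply v)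

lemma lin_act {τ : ℝ} (h : M.Fixes τ) (l : ℕ) (v : ℤ × ℤ) :
    (l : ℝ) / 4 + ((M.act l v).1 : ℤ) * τ + ((M.act l v).2 : ℤ) =
      (M.c * τ + M.a) * (l / 4 + v.1 * τ + v.2) := by
  have hc := M.c_ne_zero
  rw [act_fst, act_snd]
  unfold Fixes at h
  have : M.c * ((l : ℝ) / 4 + v.1 * (M.d / M.c) + v.2) = M.c * (l / 4 + v.2) + M.d * v.1 := by
    field_simp
    ring
  rw [this]
  linear_combination (-(v.1 : ℝ)) * h

variable {τ : ℝ} {s k : ℕ}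

lemma summable_coneTerm (hτ : BadlyApproximable τ) (hE : M.c * τ + M.a ≠ 0) (l : ℕ)
    (hk : 1 ≤ k) (hs : k < s) :
    Summable fun p : ℤ × ℤ => coneTerm s k (p.1 : ℝ)⁻¹
      ((M.c * τ + M.a) / M.c * ((l : ℝ) / 4 + p.1 * τ + p.2)⁻¹)
      ((M.c * τ + M.a) * (M.preFst l p : ℝ)⁻¹) := by
  rcases hk.eq_or_lt with rfl | hk2
  · exact M.summable_coneTerm_one l hτ hE (by omega)
  · exact summable_coneTerm_of_two_le hτ l _ hk2 hs _

lemma hasSum_rational (l : ℕ) {k i : ℕ} (hk : 1 ≤ k) (hi : 2 ≤ i) (β : ℚ) :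
    ∃ r : ℚ, HasSum (fun n : ℤ => cotSum k ((l : ℝ) / 4 + n * β) * ((n : ℝ)⁻¹) ^ i)
      (cotSeries l k i β) ∧ cotSeries l k i β = Real.pi ^ (k + i) * r := by
  obtain ⟨r, hr⟩ := hasSum_cotSum_rational hk hi l β
  exact ⟨r, hr.summable.hasSum, hr.tsum_eq⟩

lemma tsum_coneTerm (hirr : Irrational τ) (hτ : BadlyApproximable τ) (hE : M.c * τ + M.a ≠ 0)
    (l : ℕ) (hk : 1 ≤ k) (hs : k < s) :
    ∑' p : ℤ × ℤ, coneTerm s k (p.1 : ℝ)⁻¹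
      ((M.c * τ + M.a) / M.c * ((l : ℝ) / 4 + p.1 * τ + p.2)⁻¹)
      ((M.c * τ + M.a) * (M.preFst l p : ℝ)⁻¹) =
    ((M.c * τ + M.a) / M.c) ^ k * cotSeries l k s τ +
      if k = 1 then (M.c * τ + M.a) * (-M.c)⁻¹ * cotSeries l 1 s (-M.a / M.c) else 0 := by
  set E := M.c * τ + M.a with hE_def
  have hc := M.c_ne_zero
  have hsum := M.summable_coneTerm hτ hE l hk hs
  rw [hsum.tsum_prod]
  have hinner : ∀ n : ℤ, ∑' m : ℤ, coneTerm s k (n : ℝ)⁻¹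
      (E / M.c * ((l : ℝ) / 4 + n * τ + m)⁻¹) (E * (M.preFst l (n, m) : ℝ)⁻¹) =
      (E / M.c) ^ k * (cotSum k ((l : ℝ) / 4 + n * τ) * ((n : ℝ)⁻¹) ^ s) +
      if k = 1 then E * (-M.c)⁻¹ *
        (cotSum 1 ((l : ℝ) / 4 + n * (-M.a / M.c)) * ((n : ℝ)⁻¹) ^ s) else 0 := by
    intro n
    have h1 := hasSum_symmetricIcc_of_hasSum (hsum.prod_factor n).hasSum
    refine h1.unique ?_
    have h2 := ((hasSum_cotSum hk ((l : ℝ) / 4 + n * τ)).mul_left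
      (((n : ℝ)⁻¹) ^ s * (E / M.c) ^ k)).add
      ((hasSum_cotSum le_rfl ((l : ℝ) / 4 + n * (-M.a / M.c))).mul_left
        (if k = 1 then ((n : ℝ)⁻¹) ^ s * (E * (-M.c)⁻¹) else 0))
    refine hasSum_of_eq h2 (fun m => ?_) ?_
    · unfold coneTerm
      have : (M.preFst l (n, m) : ℝ) = (-M.c) * ((l : ℝ) / 4 + n * (-M.a / M.c) + m) := by
        rw [preFst_real]
        field_simp
        ring
      rw [this, mul_inv, mul_pow]
      split_ifs <;> ring
    · split_ifs <;> ring
  rw [tsum_congr hinner, Summable.tsum_add ((summable_cotSum hirr hτ l hk hs).mul_left _)]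
  · rw [tsum_mul_left]
    congr 1
    split_ifs
    · rw [tsum_mul_left]
      rfl
    · exact tsum_zero
  · split_ifs
    · obtain ⟨r, hr, _⟩ := hasSum_rational l (k := 1) (i := s) le_rfl (by omega)
        (-(1 + 4 * M.a₀) / (4 * M.c₀))
      have e : ((-(1 + 4 * M.a₀) / (4 * M.c₀) : ℚ) : ℝ) = -M.a / M.c := by
        unfold a c
        push_cast
        rfl
      rw [e] at hr
      exact hr.summable.mul_left _
    · exact summable_zero


section Relation

variable {p q : ℕ → ℤ}

/-- The right hand side of the partial fraction decomposition, on the lattice. -/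
noncomputable def coneSum (p q : ℕ → ℤ) (s k l : ℕ) (τ E : ℝ) (v : ℤ × ℤ) : ℝ :=
  ∑ i ∈ Finset.range k, p i * (E * (v.1 : ℝ)⁻¹) ^ (s + i) *
    (M.c⁻¹ * ((l : ℝ) / 4 + v.1 * τ + v.2)⁻¹) ^ (k - i) +
  ∑ j ∈ Finset.range (s + k - 2), q j * (E * (v.1 : ℝ)⁻¹) ^ (s + k - 1 - j) *
    (M.c⁻¹ * ((l : ℝ) / 4 + v.1 * (M.d / M.c) + v.2)⁻¹) ^ (j + 1)

lemma coneSum_eq (hirr : Irrational τ) (hfix : M.Fixes τ)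
    (l : ℕ) (hk : 1 ≤ k) (hs : k < s)
    (hpq : ∀ y z u : ℝ, y * z = u * (z - y) →
      y ^ s * z ^ k + (if k = 1 then y ^ s * u else 0) =
        ∑ i ∈ Finset.range k, p i * u ^ (s + i) * z ^ (k - i) +
        ∑ j ∈ Finset.range (s + k - 2), q j * u ^ (s + k - 1 - j) * y ^ (j + 1))
    {E : ℝ} (hE : E = M.c * τ + M.a) (v : ℤ × ℤ) {w : ℤ × ℤ} (hw : w = M.act l v) :
    M.coneSum p q s k l τ E v =
      coneTerm s k (w.1 : ℝ)⁻¹ (E / M.c * ((l : ℝ) / 4 + w.1 * τ + w.2)⁻¹)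
        (E * (M.preFst l w : ℝ)⁻¹) -
      (if v.1 = 0 then M.c⁻¹ ^ (s + k) * (((l : ℝ) / 4 + v.2)⁻¹) ^ (s + k) else 0) +
      if w.1 = 0 then (∑ i ∈ Finset.range k, (p i : ℝ) * (-1) ^ (k - i)) *
        (E * (-M.c)⁻¹) ^ (s + k) * (((l : ℝ) / 4 + w.2)⁻¹) ^ (s + k) else 0 := by
  have hc := M.c_ne_zero
  have hη := hfix.mul_eq
  rw [← hE] at hη
  have hE0 : E ≠ 0 := left_ne_zero_of_mul (by rw [hη]; exact one_ne_zero)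
  have hy : (w.1 : ℝ) = M.c * (l / 4 + v.1 * (M.d / M.c) + v.2) := by rw [hw, M.act_fst]
  have hpre : M.preFst l w = v.1 := by rw [hw, M.preFst_act]
  have hlin : (l : ℝ) / 4 + w.1 * τ + w.2 = E * (l / 4 + v.1 * τ + v.2) := by
    rw [hw, hE, M.lin_act hfix]
  have hEinv : E⁻¹ = M.d - M.c * τ := by
    rw [inv_eq_iff_eq_inv, eq_comm, inv_eq_of_mul_eq_one_left hη]
  have key := coneTerm_eq hk hs hpq (Y := w.1) (Z := M.c * (l / 4 + v.1 * τ + v.2))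
    (U := E⁻¹ * v.1) (by
      rw [hy, hEinv]
      field_simp
      ring) (by
      intro h0
      have h1 := (mul_eq_zero.1 h0).resolve_left hc
      by_cases hv : v.1 = 0
      · rw [hv, Int.cast_zero, mul_zero]
      · refine absurd ?_ (ne_int_of_irrational hirr l hv (-v.2))
        push_cast
        linarith)
  have hU0 : E⁻¹ * (v.1 : ℝ) = 0 ↔ v.1 = 0 := by
    rw [mul_eq_zero]
    simp [hE0]
  have hW0 : (w.1 : ℝ) = 0 ↔ w.1 = 0 := Int.cast_eq_zero
  have hUinv : (E⁻¹ * (v.1 : ℝ))⁻¹ = E * (v.1 : ℝ)⁻¹ := by rw [mul_inv, inv_inv]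
  have hYinv : (w.1 : ℝ)⁻¹ = M.c⁻¹ * ((l : ℝ) / 4 + v.1 * (M.d / M.c) + v.2)⁻¹ := by
    rw [hy, mul_inv]
  have hZinv : E / M.c * ((l : ℝ) / 4 + w.1 * τ + w.2)⁻¹ =
      M.c⁻¹ * ((l : ℝ) / 4 + v.1 * τ + v.2)⁻¹ := by
    rw [hlin, mul_inv]
    field_simp
  rw [hUinv, mul_inv] at key
  unfold coneSum
  rw [← hYinv, key, hZinv, hpre]
  congr 1
  · congr 1
    by_cases hv : v.1 = 0
    · rw [if_pos (hU0.2 hv), if_pos hv, hYinv, mul_pow, hv, Int.cast_zero, zero_mul, add_zero]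
    · rw [if_neg (fun h => hv (hU0.1 h)), if_neg hv]
  · by_cases hw0 : w.1 = 0
    · rw [if_pos (hW0.2 hw0), if_pos hw0]
      have hv : (v.1 : ℝ) = -M.c * ((l : ℝ) / 4 + w.2) := by
        rw [← hpre, preFst_real, hw0, Int.cast_zero]
        ring
      rw [hv, mul_inv, ← mul_assoc, mul_pow, mul_assoc]
    · rw [if_neg (fun h => hw0 (hW0.1 h)), if_neg hw0]

lemma tsum_coneSum (hirr : Irrational τ) (hτ : BadlyApproximable τ) (E : ℝ)
    (l : ℕ) (hs : k < s) (hsum : Summable (M.coneSum p q s k l τ E)) :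
    ∑' v, M.coneSum p q s k l τ E v =
      ∑ i ∈ Finset.range k, p i * E ^ (s + i) * M.c⁻¹ ^ (k - i) *
        cotSeries l (k - i) (s + i) τ +
      ∑ j ∈ Finset.range (s + k - 2), q j * E ^ (s + k - 1 - j) * M.c⁻¹ ^ (j + 1) *
        cotSeries l (j + 1) (s + k - 1 - j) (M.d / M.c) := by
  rw [hsum.tsum_prod]
  have hinner : ∀ n : ℤ, ∑' m : ℤ, M.coneSum p q s k l τ E (n, m) =
      ∑ i ∈ Finset.range k, p i * E ^ (s + i) * M.c⁻¹ ^ (k - i) *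
        (cotSum (k - i) ((l : ℝ) / 4 + n * τ) * ((n : ℝ)⁻¹) ^ (s + i)) +
      ∑ j ∈ Finset.range (s + k - 2), q j * E ^ (s + k - 1 - j) * M.c⁻¹ ^ (j + 1) *
        (cotSum (j + 1) ((l : ℝ) / 4 + n * (M.d / M.c)) * ((n : ℝ)⁻¹) ^ (s + k - 1 - j)) := by
    intro n
    refine (hasSum_symmetricIcc_of_hasSum (hsum.prod_factor n).hasSum).unique ?_
    have h1 : ∀ i ∈ Finset.range k, HasSum (fun m : ℤ => (p i : ℝ) * (E * (n : ℝ)⁻¹) ^ (s + i) *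
        (M.c⁻¹ * ((l : ℝ) / 4 + n * τ + m)⁻¹) ^ (k - i)) (p i * E ^ (s + i) * M.c⁻¹ ^ (k - i) *
        (cotSum (k - i) ((l : ℝ) / 4 + n * τ) * ((n : ℝ)⁻¹) ^ (s + i))) (symmetricIcc ℤ) := by
      intro i hi
      have := Finset.mem_range.1 hi
      refine hasSum_of_eq ((hasSum_cotSum (k := k - i) (by omega) ((l : ℝ) / 4 + n * τ)).mul_left
        ((p i : ℝ) * (E * (n : ℝ)⁻¹) ^ (s + i) * M.c⁻¹ ^ (k - i))) (fun m => ?_) ?_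
      · rw [mul_pow M.c⁻¹]
        ring
      · rw [mul_pow]
        ring
    have h2 : ∀ j ∈ Finset.range (s + k - 2), HasSum (fun m : ℤ =>
        (q j : ℝ) * (E * (n : ℝ)⁻¹) ^ (s + k - 1 - j) *
        (M.c⁻¹ * ((l : ℝ) / 4 + n * (M.d / M.c) + m)⁻¹) ^ (j + 1))
        (q j * E ^ (s + k - 1 - j) * M.c⁻¹ ^ (j + 1) *
        (cotSum (j + 1) ((l : ℝ) / 4 + n * (M.d / M.c)) * ((n : ℝ)⁻¹) ^ (s + k - 1 - j)))
        (symmetricIcc ℤ) := by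
      intro j _
      refine hasSum_of_eq ((hasSum_cotSum (k := j + 1) (by omega)
        ((l : ℝ) / 4 + n * (M.d / M.c))).mul_left
        ((q j : ℝ) * (E * (n : ℝ)⁻¹) ^ (s + k - 1 - j) * M.c⁻¹ ^ (j + 1))) (fun m => ?_) ?_
      · rw [mul_pow M.c⁻¹]
        ring
      · rw [mul_pow]
        ring
    exact (hasSum_sum h1).add (hasSum_sum h2)
  have s1 : ∀ i ∈ Finset.range k, Summable fun n : ℤ => (p i : ℝ) * E ^ (s + i) *
      M.c⁻¹ ^ (k - i) * (cotSum (k - i) ((l : ℝ) / 4 + n * τ) * ((n : ℝ)⁻¹) ^ (s + i)) := by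
    intro i hi
    have := Finset.mem_range.1 hi
    exact (summable_cotSum hirr hτ l (by omega) (by omega)).mul_left _
  have s2 : ∀ j ∈ Finset.range (s + k - 2), Summable fun n : ℤ => (q j : ℝ) *
      E ^ (s + k - 1 - j) * M.c⁻¹ ^ (j + 1) *
      (cotSum (j + 1) ((l : ℝ) / 4 + n * (M.d / M.c)) * ((n : ℝ)⁻¹) ^ (s + k - 1 - j)) := by
    intro j hj
    have := Finset.mem_range.1 hj
    obtain ⟨r, hr, _⟩ := hasSum_rational l (k := j + 1) (i := s + k - 1 - j) (by omega) (by omega)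
      (M.d / (4 * M.c₀))
    have e : ((M.d / (4 * M.c₀) : ℚ) : ℝ) = M.d / M.c := by
      unfold c
      push_cast
      rfl
    rw [e] at hr
    exact hr.summable.mul_left _
  rw [tsum_congr hinner, Summable.tsum_add (summable_sum s1) (summable_sum s2),
    Summable.tsum_finsetSum s1, Summable.tsum_finsetSum s2]
  simp only [tsum_mul_left]
  rfl

/-- The relation between the double series at a quadratic irrationality which results from the
invariance of the lattice under an automorphism. -/
theorem cotSeries_relation (hirr : Irrational τ) (hτ : BadlyApproximable τ) (hfix : M.Fixes τ)
    (l : ℕ) (hk : 1 ≤ k) (hs : k < s)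
    (hpq : ∀ y z u : ℝ, y * z = u * (z - y) →
      y ^ s * z ^ k + (if k = 1 then y ^ s * u else 0) =
        ∑ i ∈ Finset.range k, p i * u ^ (s + i) * z ^ (k - i) +
        ∑ j ∈ Finset.range (s + k - 2), q j * u ^ (s + k - 1 - j) * y ^ (j + 1)) :
    ((M.c * τ + M.a) / M.c) ^ k * cotSeries l k s τ +
      (if k = 1 then (M.c * τ + M.a) * (-M.c)⁻¹ * cotSeries l 1 s (-M.a / M.c) else 0) =
    ∑ i ∈ Finset.range k, p i * (M.c * τ + M.a) ^ (s + i) * M.c⁻¹ ^ (k - i) *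
        cotSeries l (k - i) (s + i) τ +
      ∑ j ∈ Finset.range (s + k - 2), q j * (M.c * τ + M.a) ^ (s + k - 1 - j) * M.c⁻¹ ^ (j + 1) *
        cotSeries l (j + 1) (s + k - 1 - j) (M.d / M.c) +
      M.c⁻¹ ^ (s + k) * cotSum (s + k) (l / 4) -
      (∑ i ∈ Finset.range k, (p i : ℝ) * (-1) ^ (k - i)) *
        ((M.c * τ + M.a) * (-M.c)⁻¹) ^ (s + k) * cotSum (s + k) (l / 4) := by
  have hE : M.c * τ + M.a ≠ 0 := left_ne_zero_of_mul (by rw [hfix.mul_eq]; exact one_ne_zero)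
  have hf := M.summable_coneTerm hτ hE l hk hs
  have hz := hasSum_cotSum_of_two_le (k := s + k) (by omega) ((l : ℝ) / 4)
  have h1 := hasSum_axis (hz.mul_left (M.c⁻¹ ^ (s + k)))
  have h2 := hasSum_axis (hz.mul_left ((∑ i ∈ Finset.range k, (p i : ℝ) * (-1) ^ (k - i)) *
    ((M.c * τ + M.a) * (-M.c)⁻¹) ^ (s + k)))
  have h3 := (((M.act l).hasSum_iff.2 hf.hasSum).sub h1).add ((M.act l).hasSum_iff.2 h2)
  have h4 : HasSum (M.coneSum p q s k l τ (M.c * τ + M.a)) _ :=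
    hasSum_of_eq h3 (fun v => M.coneSum_eq hirr hfix l hk hs hpq rfl v rfl) rfl
  have h5 := h4.tsum_eq
  rw [M.tsum_coneSum hirr hτ _ l hs h4.summable, M.tsum_coneTerm hirr hτ hE l hk hs] at h5
  linarith

end Relation

end CongruenceMatrix

end TrigDirichlet

namespace TrigDirichlet

open Filter Topology SummationFilter Polynomial

/-- Every real quadratic irrationality is fixed by a matrix from a congruence subgroup. -/
lemma exists_congruenceMatrix {A B C : ℤ} (hA : A ≠ 0) {τ : ℝ} (hτ : Irrational τ)
    (h : (A : ℝ) * τ ^ 2 + B * τ + C = 0) :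
    ∃ M : CongruenceMatrix, ∀ t : ℝ, (A : ℝ) * t ^ 2 + B * t + C = 0 → M.Fixes t := by
  set D : ℤ := B ^ 2 - 4 * A * C with hD
  have hirr : Irrational (((8 * A : ℤ) : ℝ) * τ + ((4 * B : ℤ) : ℝ)) :=
    (hτ.intCast_mul (by omega)).add_intCast _
  have hsq : (((8 * A : ℤ) : ℝ) * τ + ((4 * B : ℤ) : ℝ)) ^ 2 = ((16 * D : ℤ) : ℝ) := by
    rw [hD]
    push_cast
    linear_combination (64 * (A : ℝ)) * h
  have hpos : 0 < 16 * D := by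
    have h1 : (0 : ℝ) < ((16 * D : ℤ) : ℝ) := by
      rw [← hsq]
      have := hirr.ne_zero
      positivity
    exact_mod_cast h1
  have hns : ¬ IsSquare (16 * D) := by
    rintro ⟨r, hr⟩
    rw [hr] at hsq
    push_cast at hsq
    rw [← pow_two, sq_eq_sq_iff_eq_or_eq_neg] at hsq
    rcases hsq with h1 | h1
    · exact hirr.ne_int r (by push_cast; exact h1)
    · exact hirr.ne_int (-r) (by push_cast; exact h1)
  obtain ⟨x, y, hxy, hy⟩ := Pell.exists_of_not_isSquare hpos hns
  have hx : x ≠ 0 := by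
    rintro rfl
    have : 0 ≤ 16 * D * y ^ 2 := by positivity
    linarith
  refine ⟨⟨8 * D * y ^ 2 + 2 * B * x * y, -16 * C * x * y, 4 * A * x * y,
    1 + 32 * D * y ^ 2 - 8 * B * x * y, ?_, ?_⟩, fun t ht => ?_⟩
  · linear_combination (-64 * y ^ 2 * D) * hxy + (-64 * x ^ 2 * y ^ 2) * hD
  · exact mul_ne_zero (mul_ne_zero (mul_ne_zero (by norm_num) hA) hx) hy
  · unfold CongruenceMatrix.Fixes CongruenceMatrix.a CongruenceMatrix.c
    push_cast
    linear_combination (16 * (x : ℝ) * y) * ht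

section Period

variable {K ι : Type*} [Field K] (σ : ι → K →+* ℝ)

/-- The family `r` is `π ^ w` times the family of conjugates of an element of `K`. -/
def IsPeriod (w : ℕ) (r : ι → ℝ) : Prop := ∃ x : K, ∀ i, r i = Real.pi ^ w * σ i x

variable {σ} {w : ℕ} {r r' : ι → ℝ}

lemma IsPeriod.add (h : IsPeriod σ w r) (h' : IsPeriod σ w r') :
    IsPeriod σ w fun i => r i + r' i := by
  obtain ⟨x, hx⟩ := h
  obtain ⟨y, hy⟩ := h'
  exact ⟨x + y, fun i => by simp only [hx, hy, map_add, mul_add]⟩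

lemma IsPeriod.mul_left (h : IsPeriod σ w r) (y : K) : IsPeriod σ w fun i => σ i y * r i := by
  obtain ⟨x, hx⟩ := h
  exact ⟨y * x, fun i => by simp only [hx, map_mul]; ring⟩

lemma IsPeriod.congr (h : IsPeriod σ w r) (hr : ∀ i, r' i = r i) : IsPeriod σ w r' := by
  obtain ⟨x, hx⟩ := h
  exact ⟨x, fun i => by rw [hr, hx]⟩

lemma IsPeriod.sub (h : IsPeriod σ w r) (h' : IsPeriod σ w r') :
    IsPeriod σ w fun i => r i - r' i :=
  (h.add (h'.mul_left (-1))).congr fun i => by rw [map_neg, map_one]; ring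

lemma IsPeriod.zero : IsPeriod σ w fun _ => 0 := ⟨0, fun i => by simp⟩

lemma IsPeriod.sum {s : Finset ℕ} {f : ℕ → ι → ℝ} (h : ∀ j ∈ s, IsPeriod σ w (f j)) :
    IsPeriod σ w fun i => ∑ j ∈ s, f j i := by
  classical
  induction s using Finset.induction_on with
  | empty => exact IsPeriod.zero
  | insert a s ha ih =>
    refine ((h a (Finset.mem_insert_self _ _)).add
      (ih fun j hj => h j (Finset.mem_insert_of_mem hj))).congr fun i => ?_
    rw [Finset.sum_insert ha]

lemma isPeriod_rat [CharZero K] {r : ℝ} {q : ℚ} (h : r = Real.pi ^ w * q) :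
    IsPeriod σ w fun _ => r := ⟨q, fun i => by rw [map_ratCast, h]⟩

lemma IsPeriod.rat_mul [CharZero K] (h : IsPeriod σ w r) (q : ℚ) :
    IsPeriod σ w fun i => (q : ℝ) * r i :=
  (h.mul_left (q : K)).congr fun i => by rw [map_ratCast]

end Period

section Core

lemma exists_cot_quarter (l : ℕ) : ∃ q : ℚ, Real.cot (Real.pi * (l / 4)) = q := by
  set x := Real.pi * ((l : ℝ) / 4) with hx
  have h1 : Real.sin (2 * (2 * x)) = 0 := by
    rw [show 2 * (2 * x) = l * Real.pi by rw [hx]; ring]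
    exact Real.sin_nat_mul_pi l
  rw [Real.sin_two_mul, Real.sin_two_mul, Real.cos_two_mul'] at h1
  rw [Real.cot_eq_cos_div_sin]
  by_cases hs : Real.sin x = 0
  · exact ⟨0, by rw [hs]; simp⟩
  · have h2 : Real.cos x * ((Real.cos x - Real.sin x) * (Real.cos x + Real.sin x)) = 0 := by
      have h3 : 4 * Real.sin x *
          (Real.cos x * ((Real.cos x - Real.sin x) * (Real.cos x + Real.sin x))) = 0 := by
        linear_combination h1
      exact (mul_eq_zero.1 h3).resolve_left (by positivity)
    rcases mul_eq_zero.1 h2 with h | h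
    · exact ⟨0, by rw [h]; simp⟩
    · rcases mul_eq_zero.1 h with h | h
      · exact ⟨1, by rw [sub_eq_zero.1 h, div_self hs]; simp⟩
      · exact ⟨-1, by rw [eq_neg_of_add_eq_zero_left h, neg_div, div_self hs]; simp⟩

lemma exists_cotSum_quarter {k : ℕ} (hk : 1 ≤ k) (l : ℕ) :
    ∃ q : ℚ, cotSum k ((l : ℝ) / 4) = Real.pi ^ k * q := by
  by_cases hl : ∃ m : ℤ, (l : ℝ) / 4 = m
  · obtain ⟨m, hm⟩ := hl
    obtain ⟨q, hq⟩ := cotSum_int hk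
    exact ⟨q, by rw [hm, hq]⟩
  · push Not at hl
    obtain ⟨j, rfl⟩ : ∃ j, k = j + 1 := ⟨k - 1, by omega⟩
    obtain ⟨q, hq⟩ := exists_cot_quarter l
    refine ⟨(cotPoly j).eval q, ?_⟩
    rw [cotSum_eq hl, hq]
    congr 1
    exact eval₂_at_apply (algebraMap ℚ ℝ) q

variable {K ι : Type*} [Field K] [CharZero K] {σ : ι → K →+* ℝ} {ω : K}

lemma isPeriod_cotSeries (hirr : ∀ i, Irrational (σ i ω)) (hbad : ∀ i, BadlyApproximable (σ i ω))
    (M : CongruenceMatrix) (hfix : ∀ i, M.Fixes (σ i ω)) (l : ℕ) {k : ℕ} (hk : 1 ≤ k) :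
    ∀ {s : ℕ}, k < s → IsPeriod σ (k + s) fun i => cotSeries l k s (σ i ω) := by
  induction k using Nat.strong_induction_on with
  | _ k ih =>
  intro s hs
  rcases isEmpty_or_nonempty ι with hι | ⟨⟨i₀⟩⟩
  · exact ⟨0, fun i => (hι.false i).elim⟩
  obtain ⟨p, q, hp0, hpq⟩ := exists_partial_fraction (s := s) (k := k) (by omega) hk
  set c : K := 4 * M.c₀ with hc_def
  set e : K := c * ω + (1 + 4 * M.a₀) with he_def
  have hc : ∀ i, M.c = σ i c := fun i => by
    rw [hc_def, CongruenceMatrix.c, map_mul, map_ofNat, map_intCast]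
  have he : ∀ i, M.c * σ i ω + M.a = σ i e := fun i => by
    rw [he_def, hc i, CongruenceMatrix.a]
    simp only [map_add, map_mul, map_one, map_ofNat, map_intCast]
  have hc0 : c ≠ 0 := by
    intro h0
    have := hc i₀
    rw [h0, map_zero] at this
    exact M.c_ne_zero this
  have hEirr : Irrational (σ i₀ e) := by
    rw [← he i₀]
    have h1 : M.c = ((4 * M.c₀ : ℤ) : ℝ) := by simp [CongruenceMatrix.c]
    have h2 : M.a = ((1 + 4 * M.a₀ : ℤ) : ℝ) := by simp [CongruenceMatrix.a]
    rw [h1, h2]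
    exact ((hirr i₀).intCast_mul (mul_ne_zero (by norm_num) M.c₀_ne_zero)).add_intCast _
  have hee : e ^ k - e ^ s ≠ 0 := by
    intro h0
    have h1 : σ i₀ e ^ k = σ i₀ e ^ s := by
      rw [← map_pow, ← map_pow, sub_eq_zero.1 h0]
    rw [show s = k + (s - k) by omega, pow_add] at h1
    have h2 : σ i₀ e ^ (s - k) = 1 := by
      have := pow_ne_zero k hEirr.ne_zero
      exact (mul_left_cancel₀ this (by rw [← h1, mul_one])).symm
    rcases (pow_eq_one_iff_of_ne_zero (by omega)).1 h2 with h3 | ⟨h3, _⟩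
    · exact hEirr.ne_one h3
    · exact hEirr.ne_int (-1) (by push_cast; exact h3)
  obtain ⟨k', rfl⟩ : ∃ k', k = k' + 1 := ⟨k - 1, by omega⟩
  have hrel := fun i => M.cotSeries_relation (hirr i) (hbad i) (hfix i) l hk hs hpq
  simp only [he, Finset.sum_range_succ' _ k', hp0] at hrel
  -- the terms of the relation other than the leading ones
  have t1 : IsPeriod σ (k' + 1 + s) fun i => ∑ j ∈ Finset.range k', (p (j + 1) : ℝ) *
      σ i e ^ (s + (j + 1)) * (σ i c)⁻¹ ^ (k' + 1 - (j + 1)) *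
      cotSeries l (k' + 1 - (j + 1)) (s + (j + 1)) (σ i ω) := by
    refine IsPeriod.sum fun j hj => ?_
    have := Finset.mem_range.1 hj
    have h1 := ih (k' + 1 - (j + 1)) (by omega) (by omega) (s := s + (j + 1)) (by omega)
    rw [show k' + 1 - (j + 1) + (s + (j + 1)) = k' + 1 + s by omega] at h1
    refine (h1.mul_left (p (j + 1) * e ^ (s + (j + 1)) * c⁻¹ ^ (k' + 1 - (j + 1)))).congr
      fun i => ?_
    simp
  have t2 : IsPeriod σ (k' + 1 + s) fun i => ∑ j ∈ Finset.range (s + (k' + 1) - 2), (q j : ℝ) *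
      σ i e ^ (s + (k' + 1) - 1 - j) * (σ i c)⁻¹ ^ (j + 1) *
      cotSeries l (j + 1) (s + (k' + 1) - 1 - j) (M.d / σ i c) := by
    refine IsPeriod.sum fun j hj => ?_
    have := Finset.mem_range.1 hj
    obtain ⟨r, _, hr⟩ := CongruenceMatrix.hasSum_rational l (k := j + 1)
      (i := s + (k' + 1) - 1 - j) (by omega) (by omega) (M.d / (4 * M.c₀))
    rw [show j + 1 + (s + (k' + 1) - 1 - j) = k' + 1 + s by omega] at hr
    refine ((isPeriod_rat hr).mul_left
      (q j * e ^ (s + (k' + 1) - 1 - j) * c⁻¹ ^ (j + 1))).congr fun i => ?_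
    have e1 : ((M.d / (4 * M.c₀) : ℚ) : ℝ) = M.d / σ i c := by
      rw [← hc i, CongruenceMatrix.c]
      push_cast
      rfl
    rw [e1]
    simp
  have t3 : IsPeriod σ (k' + 1 + s) fun i => if k' + 1 = 1 then
      σ i e * (-σ i c)⁻¹ * cotSeries l 1 s (-M.a / σ i c) else 0 := by
    split_ifs with hk1
    · obtain ⟨r, _, hr⟩ := CongruenceMatrix.hasSum_rational l (k := 1)
        (i := s) (by omega) (by omega) (-(1 + 4 * M.a₀) / (4 * M.c₀))
      rw [← hk1] at hr
      refine ((isPeriod_rat hr).mul_left (e * (-c)⁻¹)).congr fun i => ?_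
      have e1 : ((-(1 + 4 * M.a₀) / (4 * M.c₀) : ℚ) : ℝ) = -M.a / σ i c := by
        rw [← hc i, CongruenceMatrix.c, CongruenceMatrix.a]
        push_cast
        rfl
      rw [e1, hk1]
      simp
    · exact IsPeriod.zero
  have tz : IsPeriod σ (k' + 1 + s) fun _ => cotSum (s + (k' + 1)) ((l : ℝ) / 4) := by
    obtain ⟨r, hr⟩ := exists_cotSum_quarter (k := s + (k' + 1)) (by omega) l
    rw [add_comm s] at hr ⊢
    exact isPeriod_rat hr
  have t4 := (tz.mul_left (c⁻¹ ^ (s + (k' + 1)))).sub (tz.mul_left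
    ((∑ i ∈ Finset.range k', (p (i + 1) : K) * (-1) ^ (k' + 1 - (i + 1)) + (-1) ^ (k' + 1)) *
      (e * (-c)⁻¹) ^ (s + (k' + 1))))
  refine ((((t1.add t2).add t4).sub t3).mul_left (c ^ (k' + 1) * (e ^ (k' + 1) - e ^ s)⁻¹)).congr
    fun i => ?_
  have h := hrel i
  rw [hc i] at h
  have hci : σ i c ≠ 0 := (map_ne_zero (σ i)).2 hc0
  have heei : σ i e ^ (k' + 1) - σ i e ^ s ≠ 0 := by
    rw [← map_pow, ← map_pow, ← map_sub]
    exact (map_ne_zero (σ i)).2 hee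
  simp only [map_mul, map_inv₀, map_sub, map_pow, map_add, map_sum, map_neg, map_one,
    map_intCast]
  simp only [Int.cast_one, one_mul, add_zero, Nat.sub_zero] at h
  have hci' : σ i c ^ (k' + 1) * (σ i c)⁻¹ ^ (k' + 1) = 1 := by
    rw [← mul_pow, mul_inv_cancel₀ hci, one_pow]
  rw [div_eq_mul_inv, mul_pow] at h
  rw [mul_right_comm, ← div_eq_mul_inv, eq_div_iff heei]
  linear_combination σ i c ^ (k' + 1) * h -
    (σ i e ^ (k' + 1) - σ i e ^ s) * cotSeries l (k' + 1) s (σ i ω) * hci'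

lemma isPeriod_cot_pow (hirr : ∀ i, Irrational (σ i ω)) (hbad : ∀ i, BadlyApproximable (σ i ω))
    (M : CongruenceMatrix) (hfix : ∀ i, M.Fixes (σ i ω)) (l : ℕ) {k s : ℕ} (hs2 : 2 ≤ s)
    (hs : k < s) : IsPeriod σ s fun i =>
      ∑' n : ℤ, Real.cot (Real.pi * (l / 4 + n * σ i ω)) ^ k * ((n : ℝ)⁻¹) ^ s := by
  induction k using Nat.strong_induction_on with
  | _ k ih =>
  rcases Nat.eq_zero_or_pos k with rfl | hk
  · obtain ⟨q, hq⟩ := hasSum_zeta_int hs2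
    refine (isPeriod_rat hq.tsum_eq).congr fun i => ?_
    simp only [pow_zero, one_mul]
  · obtain ⟨j, rfl⟩ : ∃ j, k = j + 1 := ⟨k - 1, by omega⟩
    have h1 : IsPeriod σ s fun i => (Real.pi ^ (j + 1))⁻¹ * cotSeries l (j + 1) s (σ i ω) := by
      obtain ⟨x, hx⟩ := isPeriod_cotSeries hirr hbad M hfix l hk hs
      refine ⟨x, fun i => ?_⟩
      have := Real.pi_pos
      simp only [hx]
      rw [pow_add]
      field_simp
      ring
    have h2 := IsPeriod.sum (s := Finset.range (j + 1)) fun i hi =>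
      (ih i (Finset.mem_range.1 hi) (by have := Finset.mem_range.1 hi; omega)).rat_mul
        ((cotPoly j).coeff i)
    refine (h1.sub h2).congr fun i => ?_
    have h3 : cotSeries l (j + 1) s (σ i ω) = Real.pi ^ (j + 1) * ∑ a ∈ Finset.range (j + 2),
        ((cotPoly j).coeff a : ℝ) *
        ∑' n : ℤ, Real.cot (Real.pi * (l / 4 + n * σ i ω)) ^ a * ((n : ℝ)⁻¹) ^ s := by
      simp only [← tsum_mul_left]
      rw [← Summable.tsum_finsetSum, ← tsum_mul_left]
      · refine tsum_congr fun n => ?_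
        rcases eq_or_ne n 0 with rfl | hn
        · have h0 : (((0 : ℤ) : ℝ)⁻¹) ^ s = 0 := by
            rw [Int.cast_zero, inv_zero, zero_pow (by omega)]
          simp only [h0, mul_zero, Finset.sum_const_zero]
        · rw [cotSum_eq (ne_int_of_irrational (hirr i) l hn), aeval_eq_sum_range'
            (lt_of_le_of_lt (natDegree_cotPoly_le j) (Nat.lt_succ_self _)), mul_assoc,
            Finset.sum_mul]
          congr 1
          refine Finset.sum_congr rfl fun a _ => ?_
          rw [Rat.smul_def]
          ring
      · intro a ha
        have := Finset.mem_range.1 ha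
        exact ((hbad i).summable_cot l (by omega) hs2).mul_left _
    have hpi := Real.pi_pos
    rw [h3, ← mul_assoc, inv_mul_cancel₀ (by positivity), one_mul, Finset.sum_range_succ,
      coeff_cotPoly_succ]
    push_cast
    ring

end Core

end TrigDirichlet

namespace TrigDirichlet

open Polynomial

section TrigSeries

variable {K ι : Type*} [Field K] [CharZero K] (σ : ι → K →+* ℝ) (ω : K) (s : ℕ)

/-- The series `∑ g(π n τ) / n ^ s` over the integers converges for every conjugate `τ` of `ω`,
and its values are `π ^ s` times the conjugates of an element of `K`. -/
def IsPeriodic (g : ℝ → ℝ) : Prop :=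
  (∀ i, Summable fun n : ℤ => g (Real.pi * (n * σ i ω)) * ((n : ℝ)⁻¹) ^ s) ∧
    IsPeriod σ s fun i => ∑' n : ℤ, g (Real.pi * (n * σ i ω)) * ((n : ℝ)⁻¹) ^ s

variable {σ ω s} {g g' : ℝ → ℝ}

omit [CharZero K] in
lemma IsPeriodic.add (h : IsPeriodic σ ω s g) (h' : IsPeriodic σ ω s g') :
    IsPeriodic σ ω s fun y => g y + g' y := by
  refine ⟨fun i => ((h.1 i).add (h'.1 i)).congr fun n => ?_,
    (h.2.add h'.2).congr fun i => ?_⟩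
  · ring
  · rw [← (h.1 i).tsum_add (h'.1 i)]
    exact tsum_congr fun n => by ring

lemma IsPeriodic.rat_mul (h : IsPeriodic σ ω s g) (q : ℚ) :
    IsPeriodic σ ω s fun y => q * g y := by
  refine ⟨fun i => ((h.1 i).mul_left (q : ℝ)).congr fun n => ?_,
    (h.2.rat_mul q).congr fun i => ?_⟩
  · ring
  · rw [← tsum_mul_left]
    exact tsum_congr fun n => by ring

lemma sin_four_mul_ne_zero {τ : ℝ} (hτ : Irrational τ) {n : ℤ} (hn : n ≠ 0) :
    Real.sin (4 * (Real.pi * (n * τ))) ≠ 0 := by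
  rw [Ne, Real.sin_eq_zero_iff]
  rintro ⟨m, hm⟩
  have h1 : ((4 * n : ℤ) : ℝ) * τ = m := by
    push_cast
    exact mul_left_cancel₀ Real.pi_ne_zero (by linear_combination -hm)
  exact (hτ.intCast_mul (by omega : 4 * n ≠ 0)).ne_int m h1

omit [CharZero K] in
lemma IsPeriodic.congr (hirr : ∀ i, Irrational (σ i ω)) (hs : s ≠ 0) (h : IsPeriodic σ ω s g)
    (hg : ∀ y, Real.sin (4 * y) ≠ 0 → g' y = g y) : IsPeriodic σ ω s g' := by
  have key : ∀ i (n : ℤ), g' (Real.pi * (n * σ i ω)) * ((n : ℝ)⁻¹) ^ s =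
      g (Real.pi * (n * σ i ω)) * ((n : ℝ)⁻¹) ^ s := by
    intro i n
    rcases eq_or_ne n 0 with rfl | hn
    · rw [Int.cast_zero, inv_zero, zero_pow hs, mul_zero, mul_zero]
    · rw [hg _ (sin_four_mul_ne_zero (hirr i) hn)]
  exact ⟨fun i => (h.1 i).congr fun n => (key i n).symm,
    h.2.congr fun i => tsum_congr (key i)⟩

lemma cot_add_pi_div_two (z : ℝ) : Real.cot (z + Real.pi / 2) = -(Real.cot z)⁻¹ := by
  rw [Real.cot_eq_cos_div_sin, Real.cot_eq_cos_div_sin, Real.cos_add_pi_div_two,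
    Real.sin_add_pi_div_two, inv_div, neg_div]

/-- Hypotheses on the family of conjugates of `ω` under which the cotangent series are known. -/
structure IsAdmissible (σ : ι → K →+* ℝ) (ω : K) (s : ℕ) : Prop where
  irrational : ∀ i, Irrational (σ i ω)
  badlyApproximable : ∀ i, BadlyApproximable (σ i ω)
  exists_fixes : ∃ M : CongruenceMatrix, ∀ i, M.Fixes (σ i ω)
  two_le : 2 ≤ s

variable (hω : IsAdmissible σ ω s)
include hω

lemma IsAdmissible.isPeriodic_cot_pow (l : ℕ) {k : ℕ} (hk : k < s) :
    IsPeriodic σ ω s fun y => Real.cot (y + l * (Real.pi / 4)) ^ k := by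
  have e : ∀ i (n : ℤ), Real.cot (Real.pi * (n * σ i ω) + l * (Real.pi / 4)) ^ k * ((n : ℝ)⁻¹) ^ s
      = Real.cot (Real.pi * (l / 4 + n * σ i ω)) ^ k * ((n : ℝ)⁻¹) ^ s := fun i n => by
    congr 3
    ring
  obtain ⟨M, hM⟩ := hω.exists_fixes
  exact ⟨fun i => ((hω.badlyApproximable i).summable_cot l hk hω.two_le).congr
      fun n => (e i n).symm,
    (isPeriod_cot_pow hω.irrational hω.badlyApproximable M hM l hω.two_le hk).congr
      fun i => tsum_congr (e i)⟩

lemma IsAdmissible.isPeriodic_cot_zpow (l : ℕ) {j : ℤ} (hj : |j| < s) :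
    IsPeriodic σ ω s fun y => Real.cot (y + l * (Real.pi / 4)) ^ j := by
  have hs := hω.two_le
  obtain ⟨k, rfl | rfl⟩ := j.eq_nat_or_neg
  · exact (hω.isPeriodic_cot_pow l (k := k) (by simpa using hj)).congr hω.irrational (by omega)
      fun y _ => zpow_natCast _ _
  · refine ((hω.isPeriodic_cot_pow (l + 2) (k := k) (by simpa using hj)).rat_mul
      ((-1) ^ k)).congr hω.irrational (by omega) fun y _ => ?_
    have : y + ((l + 2 : ℕ) : ℝ) * (Real.pi / 4) = y + l * (Real.pi / 4) + Real.pi / 2 := by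
      push_cast
      ring
    rw [this, cot_add_pi_div_two, zpow_neg, zpow_natCast]
    push_cast
    rw [← mul_pow, neg_one_mul, neg_neg, inv_pow]

lemma IsAdmissible.isPeriodic_laurent {w : ℝ → ℝ} (hw : ∀ y, Real.sin (4 * y) ≠ 0 → w y ≠ 0)
    (h : ∀ j : ℤ, |j| < s → IsPeriodic σ ω s fun y => w y ^ j) (p : ℕ) :
    ∀ (q : ℕ) (j : ℤ), |j| + p + q < s →
      IsPeriodic σ ω s fun y => (w y + (w y)⁻¹) ^ p * (w y - (w y)⁻¹) ^ q * w y ^ j := by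
  have hs := hω.two_le
  induction p with
  | zero =>
    intro q
    induction q with
    | zero =>
      intro j hj
      exact (h j (by push_cast at hj; omega)).congr hω.irrational (by omega)
        fun y _ => by simp
    | succ q ih =>
      intro j hj
      push_cast at hj
      refine ((ih (j + 1) (by push_cast; grind)).add ((ih (j - 1) (by push_cast; grind)).rat_mul
        (-1))).congr hω.irrational (by omega) fun y hy => ?_
      have := hw y hy
      rw [zpow_add_one₀ this, zpow_sub_one₀ this]
      push_cast
      ring
  | succ p ih =>
    intro q j hj
    push_cast at hj
    refine ((ih q (j + 1) (by grind)).add (ih q (j - 1) (by grind))).congr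
      hω.irrational (by omega) fun y hy => ?_
    have := hw y hy
    rw [zpow_add_one₀ this, zpow_sub_one₀ this]
    ring

omit hω in
lemma sin_four_mul (y : ℝ) :
    Real.sin (4 * y) = 2 * Real.sin (2 * y) * Real.cos (2 * y) := by
  rw [show 4 * y = 2 * (2 * y) by ring, Real.sin_two_mul]

lemma IsAdmissible.isPeriodic_csc_pow_mul_cot_pow {p q : ℕ} (hpq : p + q < s) :
    IsPeriodic σ ω s fun y =>
      (Real.sin (2 * y))⁻¹ ^ p * (Real.cos (2 * y) / Real.sin (2 * y)) ^ q := by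
  have hs := hω.two_le
  have key : ∀ y, Real.sin (4 * y) ≠ 0 → Real.sin y ≠ 0 ∧ Real.cos y ≠ 0 := by
    intro y hy
    rw [sin_four_mul, Real.sin_two_mul] at hy
    exact ⟨fun h => hy (by rw [h]; ring), fun h => hy (by rw [h]; ring)⟩
  refine ((hω.isPeriodic_laurent (w := fun y => Real.cot (y + (0 : ℕ) * (Real.pi / 4)))
    (fun y hy => ?_) (fun j hj => hω.isPeriodic_cot_zpow 0 hj) p q 0
    (by simp; omega)).rat_mul ((1 / 2) ^ (p + q))).congr hω.irrational (by omega) fun y hy => ?_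
  · obtain ⟨h1, h2⟩ := key y hy
    rw [Nat.cast_zero, zero_mul, add_zero, Real.cot_eq_cos_div_sin]
    exact div_ne_zero h2 h1
  · obtain ⟨h1, h2⟩ := key y hy
    simp only [Nat.cast_zero, zero_mul, add_zero, Real.cot_eq_cos_div_sin, inv_div, zpow_zero,
      mul_one]
    push_cast
    rw [pow_add, mul_mul_mul_comm, ← mul_pow, ← mul_pow, Real.sin_two_mul, Real.cos_two_mul']
    congr 2
    · field_simp
      rw [add_comm, Real.sin_sq_add_cos_sq]
    · field_simp

lemma IsAdmissible.isPeriodic_sec_pow_mul_tan_pow {p q : ℕ} (hpq : p + q < s) :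
    IsPeriodic σ ω s fun y =>
      (Real.cos (2 * y))⁻¹ ^ p * (Real.sin (2 * y) / Real.cos (2 * y)) ^ q := by
  have hs := hω.two_le
  have hsin : ∀ y, 2 * Real.sin (y + Real.pi / 4) * Real.cos (y + Real.pi / 4) =
      Real.cos (2 * y) := fun y => by
    rw [← Real.sin_two_mul, show 2 * (y + Real.pi / 4) = 2 * y + Real.pi / 2 by ring,
      Real.sin_add_pi_div_two]
  have hcos : ∀ y, Real.cos (y + Real.pi / 4) ^ 2 - Real.sin (y + Real.pi / 4) ^ 2 =
      -Real.sin (2 * y) := fun y => by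
    rw [← Real.cos_two_mul', show 2 * (y + Real.pi / 4) = 2 * y + Real.pi / 2 by ring,
      Real.cos_add_pi_div_two]
  have key : ∀ y, Real.sin (4 * y) ≠ 0 →
      Real.sin (y + Real.pi / 4) ≠ 0 ∧ Real.cos (y + Real.pi / 4) ≠ 0 := by
    intro y hy
    rw [sin_four_mul, ← hsin] at hy
    exact ⟨fun h => hy (by rw [h]; ring), fun h => hy (by rw [h]; ring)⟩
  refine ((hω.isPeriodic_laurent (w := fun y => Real.cot (y + (1 : ℕ) * (Real.pi / 4)))
    (fun y hy => ?_) (fun j hj => hω.isPeriodic_cot_zpow 1 hj) p q 0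
    (by simp; omega)).rat_mul ((1 / 2) ^ p * (-1 / 2) ^ q)).congr hω.irrational (by omega)
    fun y hy => ?_
  · obtain ⟨h1, h2⟩ := key y hy
    rw [Nat.cast_one, one_mul, Real.cot_eq_cos_div_sin]
    exact div_ne_zero h2 h1
  · obtain ⟨h1, h2⟩ := key y hy
    simp only [Nat.cast_one, one_mul, Real.cot_eq_cos_div_sin, inv_div, zpow_zero, mul_one]
    push_cast
    rw [mul_mul_mul_comm, ← mul_pow, ← mul_pow, ← neg_neg (Real.sin (2 * y)), ← hcos, ← hsin]
    set z := y + Real.pi / 4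
    congr 2
    · field_simp
      rw [add_comm, Real.sin_sq_add_cos_sq]
    · field_simp

/-- The function `sec ^ a csc ^ b` at the doubled argument. -/
noncomputable def secCsc (a b : ℤ) (y : ℝ) : ℝ := Real.cos (2 * y) ^ (-a) * Real.sin (2 * y) ^ (-b)

omit hω in
lemma secCsc_eq_add {y : ℝ} (hy : Real.sin (4 * y) ≠ 0) (a b : ℤ) :
    secCsc a b y = secCsc (a - 2) b y + secCsc a (b - 2) y := by
  rw [sin_four_mul] at hy
  have h1 : Real.sin (2 * y) ≠ 0 := fun h => hy (by rw [h]; ring)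
  have h2 : Real.cos (2 * y) ≠ 0 := fun h => hy (by rw [h]; ring)
  unfold secCsc
  rw [show -(a - 2) = -a + 2 by ring, show -(b - 2) = -b + 2 by ring, zpow_add₀ h1, zpow_add₀ h2]
  have h3 := Real.sin_sq_add_cos_sq (2 * y)
  rw [← zpow_natCast, ← zpow_natCast, Nat.cast_ofNat] at h3
  linear_combination -(Real.cos (2 * y) ^ (-a) * Real.sin (2 * y) ^ (-b)) * h3

/-- The case of nonnegative weight. -/
lemma IsAdmissible.isPeriodic_secCsc_of_nonneg {a b : ℤ} (ha : a < s) (hb : b < s)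
    (hab : 0 ≤ a + b) : IsPeriodic σ ω s (secCsc a b) := by
  have hs := hω.two_le
  obtain ⟨N, hN⟩ : ∃ N, N = a.toNat + b.toNat := ⟨_, rfl⟩
  induction N using Nat.strong_induction_on generalizing a b with
  | _ N ih =>
  rcases le_or_gt a 0 with ha0 | ha0
  · obtain ⟨q, rfl⟩ : ∃ q : ℕ, a = -q := ⟨(-a).toNat, by omega⟩
    obtain ⟨p, rfl⟩ : ∃ p : ℕ, b = p + q := ⟨(b - q).toNat, by omega⟩
    refine (hω.isPeriodic_csc_pow_mul_cot_pow (p := p) (q := q) (by omega)).congr hω.irrational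
      (by omega) fun y hy => ?_
    rw [secCsc, neg_neg, zpow_natCast, ← Nat.cast_add, zpow_neg, zpow_natCast, pow_add,
      inv_pow, div_pow]
    field_simp
  rcases le_or_gt b 0 with hb0 | hb0
  · obtain ⟨q, rfl⟩ : ∃ q : ℕ, b = -q := ⟨(-b).toNat, by omega⟩
    obtain ⟨p, rfl⟩ : ∃ p : ℕ, a = p + q := ⟨(a - q).toNat, by omega⟩
    refine (hω.isPeriodic_sec_pow_mul_tan_pow (p := p) (q := q) (by omega)).congr hω.irrational
      (by omega) fun y hy => ?_
    rw [secCsc, neg_neg, zpow_natCast, ← Nat.cast_add, zpow_neg, zpow_natCast, pow_add,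
      inv_pow, div_pow]
    field_simp
  exact ((ih _ (by omega) (a := a - 2) (b := b) (by omega) hb (by omega) rfl).add
    (ih _ (by omega) (a := a) (b := b - 2) ha (by omega) (by omega) rfl)).congr hω.irrational
    (by omega) fun y hy => secCsc_eq_add hy a b

end TrigSeries

section TrigPolynomial

variable {K : Type*} [Field K] [CharZero K]

lemma exists_re_im_two_pi_I_pow (s : ℕ) : ∃ p q : ℚ,
    (-(2 * Real.pi * Complex.I) ^ s / (s.factorial : ℂ) : ℂ) =
      ((Real.pi ^ s * p : ℝ) : ℂ) + ((Real.pi ^ s * q : ℝ) : ℂ) * Complex.I := by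
  obtain ⟨p, q, h⟩ : ∃ p q : ℚ, Complex.I ^ s = p + q * Complex.I := by
    induction s with
    | zero => exact ⟨1, 0, by simp⟩
    | succ s ih =>
      obtain ⟨p, q, h⟩ := ih
      refine ⟨-q, p, ?_⟩
      rw [pow_succ, h]
      push_cast
      linear_combination (q : ℂ) * Complex.I_sq
  refine ⟨-(2 ^ s / s.factorial) * p, -(2 ^ s / s.factorial) * q, ?_⟩
  rw [mul_pow, mul_pow, h]
  push_cast
  ring

lemma exists_hasSum_cos_sin {s : ℕ} (hs : 2 ≤ s) (σ : K →+* ℝ) (θ : K) : ∃ c d : K,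
    HasSum (fun n : ℤ => Real.cos (2 * Real.pi * (n * σ θ)) * ((n : ℝ)⁻¹) ^ s)
      (Real.pi ^ s * σ c) ∧
    HasSum (fun n : ℤ => Real.sin (2 * Real.pi * (n * σ θ)) * ((n : ℝ)⁻¹) ^ s)
      (Real.pi ^ s * σ d) := by
  obtain ⟨p, q, hpq⟩ := exists_re_im_two_pi_I_pow s
  set x : K := θ - (⌊σ θ⌋ : ℤ) with hx
  have hxf : σ x = Int.fract (σ θ) := by
    rw [hx, map_sub, map_intCast, Int.fract]
  have hB : bernoulliFun s (σ x) =
      σ (((Polynomial.bernoulli s).map (algebraMap ℚ K)).eval x) := by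
    rw [bernoulliFun, ← Polynomial.eval₂_at_apply, Polynomial.eval₂_map,
      Polynomial.eval_map]
    congr 1
    exact Subsingleton.elim _ _
  have hmem : σ x ∈ Set.Icc (0 : ℝ) 1 := by
    rw [hxf]
    exact ⟨Int.fract_nonneg _, (Int.fract_lt_one _).le⟩
  have h := hasSum_one_div_pow_mul_fourier_mul_bernoulliFun hs hmem
  rw [hpq, hB] at h
  have hterm : ∀ n : ℤ, 1 / (n : ℂ) ^ s * fourier n ((σ x : ℝ) : UnitAddCircle) =
      ((Real.cos (2 * Real.pi * (n * σ θ)) * ((n : ℝ)⁻¹) ^ s : ℝ) : ℂ) +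
      ((Real.sin (2 * Real.pi * (n * σ θ)) * ((n : ℝ)⁻¹) ^ s : ℝ) : ℂ) * Complex.I := by
    intro n
    have e1 : 2 * Real.pi * (n * σ θ) = 2 * Real.pi * (n * σ x) +
        ((n * ⌊σ θ⌋ : ℤ) : ℝ) * (2 * Real.pi) := by
      rw [hxf, Int.fract]
      push_cast
      ring
    rw [e1, Real.cos_add_int_mul_two_pi, Real.sin_add_int_mul_two_pi, fourier_coe_apply]
    have e2 : (2 * Real.pi * Complex.I * n * (σ x : ℝ) / (1 : ℝ) : ℂ) =
        ((2 * Real.pi * (n * σ x) : ℝ) : ℂ) * Complex.I := by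
      push_cast
      ring
    rw [e2, Complex.exp_mul_I]
    push_cast
    rw [one_div, inv_pow]
    ring
  have hre : ∀ u v w : ℝ, (((u : ℂ) + v * Complex.I) * w).re = u * w := fun u v w => by simp
  have him : ∀ u v w : ℝ, (((u : ℂ) + v * Complex.I) * w).im = v * w := fun u v w => by simp
  have hre' : ∀ u v : ℝ, ((u : ℂ) + v * Complex.I).re = u := fun u v => by simp
  have him' : ∀ u v : ℝ, ((u : ℂ) + v * Complex.I).im = v := fun u v => by simp
  refine ⟨p * ((Polynomial.bernoulli s).map (algebraMap ℚ K)).eval x,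
    q * ((Polynomial.bernoulli s).map (algebraMap ℚ K)).eval x,
    hasSum_of_eq (Complex.hasSum_re h) (fun n => ?_) ?_,
    hasSum_of_eq (Complex.hasSum_im h) (fun n => ?_) ?_⟩
  · exact ((congrArg Complex.re (hterm n)).trans (hre' _ _)).symm
  · rw [hre, map_mul, map_ratCast, mul_assoc]
  · exact ((congrArg Complex.im (hterm n)).trans (him' _ _)).symm
  · rw [him, map_mul, map_ratCast, mul_assoc]

variable {σ : Unit → K →+* ℝ} {ω : K} {s : ℕ}

lemma isPeriodic_cos_sin (hs : 2 ≤ s) (j : ℤ) :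
    IsPeriodic σ ω s (fun y => Real.cos (j * (2 * y))) ∧
      IsPeriodic σ ω s (fun y => Real.sin (j * (2 * y))) := by
  obtain ⟨c, d, hc, hd⟩ := exists_hasSum_cos_sin hs (σ ()) (j * ω)
  have e : ∀ n : ℤ, (j : ℝ) * (2 * (Real.pi * (n * σ () ω))) =
      2 * Real.pi * (n * σ () (j * ω)) := fun n => by
    rw [map_mul, map_intCast]
    ring
  refine ⟨⟨fun i => ?_, c, fun i => ?_⟩, ⟨fun i => ?_, d, fun i => ?_⟩⟩ <;> simp only [e]
  exacts [hc.summable, hc.tsum_eq, hd.summable, hd.tsum_eq]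

lemma isPeriodic_cos_pow_mul_sin_pow_mul (hs : 2 ≤ s) (hirr : ∀ i, Irrational (σ i ω))
    (α : ℕ) : ∀ (β : ℕ) (j : ℤ),
    IsPeriodic σ ω s (fun y => Real.cos (2 * y) ^ α * Real.sin (2 * y) ^ β *
      Real.cos (j * (2 * y))) ∧
    IsPeriodic σ ω s (fun y => Real.cos (2 * y) ^ α * Real.sin (2 * y) ^ β *
      Real.sin (j * (2 * y))) := by
  have hs0 : s ≠ 0 := by omega
  have e1 : ∀ (j : ℤ) (x : ℝ), ((j + 1 : ℤ) : ℝ) * x = j * x + x := fun j x => by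
    push_cast
    ring
  have e2 : ∀ (j : ℤ) (x : ℝ), ((j - 1 : ℤ) : ℝ) * x = j * x - x := fun j x => by
    push_cast
    ring
  induction α with
  | zero =>
    intro β
    induction β with
    | zero => simpa using isPeriodic_cos_sin hs
    | succ β ih =>
      intro j
      refine ⟨(((ih (j + 1)).2.rat_mul (1 / 2)).add ((ih (j - 1)).2.rat_mul (-1 / 2))).congr hirr
        hs0 fun y _ => ?_, (((ih (j + 1)).1.rat_mul (-1 / 2)).add
        ((ih (j - 1)).1.rat_mul (1 / 2))).congr hirr hs0 fun y _ => ?_⟩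
      · rw [e1, e2, Real.sin_add, Real.sin_sub]
        push_cast
        ring
      · rw [e1, e2, Real.cos_add, Real.cos_sub]
        push_cast
        ring
  | succ α ih =>
    intro β j
    refine ⟨(((ih β (j + 1)).1.rat_mul (1 / 2)).add ((ih β (j - 1)).1.rat_mul (1 / 2))).congr hirr
      hs0 fun y _ => ?_, (((ih β (j + 1)).2.rat_mul (1 / 2)).add
      ((ih β (j - 1)).2.rat_mul (1 / 2))).congr hirr hs0 fun y _ => ?_⟩
    · rw [e1, e2, Real.cos_add, Real.cos_sub]
      push_cast
      ring
    · rw [e1, e2, Real.sin_add, Real.sin_sub]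
      push_cast
      ring

lemma IsAdmissible.isPeriodic_secCsc (hω : IsAdmissible σ ω s) {a b : ℤ} (ha : a < s)
    (hb : b < s) : IsPeriodic σ ω s (secCsc a b) := by
  have hs := hω.two_le
  obtain ⟨N, hN⟩ : ∃ N, N = a.natAbs + b.natAbs := ⟨_, rfl⟩
  induction N using Nat.strong_induction_on generalizing a b with
  | _ N ih =>
  rcases le_or_gt 0 (a + b) with hab | hab
  · exact hω.isPeriodic_secCsc_of_nonneg ha hb hab
  rcases le_or_gt b 0 with hb0 | hb0
  · rcases le_or_gt a 0 with ha0 | ha0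
    · obtain ⟨α, rfl⟩ : ∃ α : ℕ, a = -α := ⟨(-a).toNat, by omega⟩
      obtain ⟨β, rfl⟩ : ∃ β : ℕ, b = -β := ⟨(-b).toNat, by omega⟩
      refine (isPeriodic_cos_pow_mul_sin_pow_mul hs hω.irrational α β 0).1.congr hω.irrational
        (by omega) fun y _ => ?_
      simp [secCsc]
    · refine ((ih _ (by omega) (a := a) (b := b + 2) ha (by omega) rfl).add
        ((ih _ (by omega) (a := a - 2) (b := b + 2) (by omega) (by omega) rfl).rat_mul
        (-1))).congr hω.irrational (by omega) fun y hy => ?_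
      rw [secCsc_eq_add hy a (b + 2), add_sub_cancel_right]
      push_cast
      ring
  · refine ((ih _ (by omega) (a := a + 2) (b := b) (by omega) hb rfl).add
      ((ih _ (by omega) (a := a + 2) (b := b - 2) (by omega) (by omega) rfl).rat_mul
      (-1))).congr hω.irrational (by omega) fun y hy => ?_
    rw [secCsc_eq_add hy (a + 2) b, add_sub_cancel_right]
    push_cast
    ring

end TrigPolynomial

end TrigDirichlet

namespace TrigDirichlet

section Values

lemma secCsc_neg (a b : ℤ) (y : ℝ) : secCsc a b (-y) = (-1) ^ b * secCsc a b y := by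
  rw [secCsc, secCsc, mul_neg, Real.cos_neg, Real.sin_neg, ← neg_one_mul (Real.sin _), mul_zpow,
    zpow_neg (-1 : ℝ), ← inv_zpow, inv_neg, inv_one]
  ring

lemma trigProd_eq_secCsc (a b : ℤ) (x : ℝ) : trigProd a b x = secCsc a b (x / 2) := by
  rw [trigProd, realSec, realCsc, secCsc, one_div, one_div, inv_zpow', inv_zpow',
    mul_div_cancel₀ x two_ne_zero]

lemma psiTerm_eq (a b : ℤ) (s : ℕ) (τ : ℝ) (n : ℕ+) :
    psiTerm a b s (2 * τ) n =
      secCsc a b (Real.pi * (((n : ℤ) : ℝ) * τ)) * (((n : ℤ) : ℝ)⁻¹) ^ s := by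
  rw [psiTerm, trigProd_eq_secCsc, zpow_natCast, inv_pow, div_eq_mul_inv]
  simp only [Int.cast_natCast]
  congr 2
  ring

lemma psi_neg (a b s : ℤ) (ρ : ℝ) : psi a b s (-ρ) = (-1) ^ b * psi a b s ρ := by
  rw [psi, psi, ← tsum_mul_left]
  refine tsum_congr fun n => ?_
  rw [psiTerm, psiTerm, trigProd_eq_secCsc, trigProd_eq_secCsc, mul_neg, neg_div, secCsc_neg]
  ring

lemma psi_eq_tsum_int {a b : ℤ} {s : ℕ} (hs : s ≠ 0) (hb : Even (b + s)) {τ : ℝ}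
    (h : Summable fun n : ℤ => secCsc a b (Real.pi * (n * τ)) * ((n : ℝ)⁻¹) ^ s) :
    psi a b s (2 * τ) =
      1 / 2 * ∑' n : ℤ, secCsc a b (Real.pi * (n * τ)) * ((n : ℝ)⁻¹) ^ s := by
  rw [tsum_int_eq_zero_add_two_mul_tsum_pnat (fun n => ?_) h, psi]
  · simp only [psiTerm_eq, Int.cast_zero, inv_zero, zero_pow hs, mul_zero, zero_add]
    ring
  · have h1 := hb.neg_one_zpow (α := ℝ)
    rw [zpow_add₀ (by norm_num), zpow_natCast] at h1
    rw [Int.cast_neg, neg_mul, mul_neg, secCsc_neg, inv_neg, neg_pow]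
    linear_combination secCsc a b (Real.pi * (n * τ)) * ((n : ℝ)⁻¹) ^ s * h1

lemma summable_psiTerm {a b : ℤ} {s : ℕ} {τ : ℝ}
    (h : Summable fun n : ℤ => secCsc a b (Real.pi * (n * τ)) * ((n : ℝ)⁻¹) ^ s) :
    Summable (psiTerm a b s (2 * τ)) := by
  have hinj : Function.Injective fun n : ℕ+ => (n : ℤ) := fun m n hmn =>
    PNat.coe_injective (Nat.cast_injective hmn)
  exact (h.comp_injective hinj).congr fun n => (psiTerm_eq a b s τ n).symm

variable {K ι : Type*} [Field K] [CharZero K] {σ : ι → K →+* ℝ}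

omit [CharZero K] in
lemma isAdmissible_half {A B C : ℤ} (hA : A ≠ 0) {ω : K} (hω : ∀ i, Irrational (σ i ω))
    (h : ∀ i, (A : ℝ) * σ i ω ^ 2 + B * σ i ω + C = 0) {s : ℕ} (hs : 2 ≤ s) :
    IsAdmissible σ (ω / 2) s := by
  have e : ∀ i, σ i (ω / 2) = σ i ω / 2 := fun i => by rw [map_div₀, map_ofNat]
  have hirr : ∀ i, Irrational (σ i (ω / 2)) := fun i => by
    rw [e]
    exact_mod_cast (hω i).div_natCast two_ne_zero
  have hA' : 4 * A ≠ 0 := by omega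
  have hq : ∀ i, ((4 * A : ℤ) : ℝ) * σ i (ω / 2) ^ 2 + ((2 * B : ℤ) : ℝ) * σ i (ω / 2) + C = 0 :=
    fun i => by
      rw [e]
      push_cast
      linear_combination h i
  refine ⟨hirr, fun i => badlyApproximable_of_quadratic (hirr i) hA' (hq i), ?_, hs⟩
  rcases isEmpty_or_nonempty ι with hι | ⟨⟨i₀⟩⟩
  · exact ⟨⟨0, 0, 1, 1, by norm_num, by norm_num⟩, fun i => (hι.false i).elim⟩
  · obtain ⟨M, hM⟩ := exists_congruenceMatrix hA' (hirr i₀) (hq i₀)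
    exact ⟨M, fun i => hM _ (hq i)⟩

omit [CharZero K] in
lemma IsPeriodic.summable_psiTerm {ω : K} {a b : ℤ} {s : ℕ}
    (h : IsPeriodic σ (ω / 2) s (secCsc a b)) (i : ι) : Summable (psiTerm a b s (σ i ω)) := by
  have e : σ i ω = 2 * σ i (ω / 2) := by rw [map_div₀, map_ofNat]; ring
  rw [e]
  exact TrigDirichlet.summable_psiTerm (h.1 i)

lemma IsPeriodic.exists_psi_eq {ω : K} {a b : ℤ} {s : ℕ} (hs : s ≠ 0) (hb : Even (b + s))
    (h : IsPeriodic σ (ω / 2) s (secCsc a b)) :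
    ∃ x : K, ∀ i, psi a b s (σ i ω) = Real.pi ^ s * σ i x := by
  obtain ⟨x, hx⟩ := h.2.rat_mul (1 / 2)
  refine ⟨x, fun i => ?_⟩
  have e : σ i ω = 2 * σ i (ω / 2) := by rw [map_div₀, map_ofNat]; ring
  rw [← hx, e, psi_eq_tsum_int hs hb (h.1 i)]
  push_cast
  rfl

end Values

lemma exists_psi_eq_of_sq_eq_rat {ρ : ℝ} (hρ : Irrational ρ) {r : ℚ} (hr : ρ ^ 2 = r) {a b : ℤ}
    {s : ℕ} (hs : 2 ≤ s) (ha : a < s) (hb : b < s) (hab : 0 ≤ a + b) (hpar : Even (b + s)) :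
    ∃ p q : ℚ, psi a b s ρ = Real.pi ^ s * (p + q * ρ) ∧
      psi a b s (-ρ) = Real.pi ^ s * (p - q * ρ) := by
  have hfact : Fact (∀ t : ℚ, t ^ 2 ≠ r + 0 * t) := by
    refine ⟨fun t ht => ?_⟩
    have h1 : ρ ^ 2 = (t : ℝ) ^ 2 := by
      rw [hr]
      exact_mod_cast (by rw [ht]; ring : r = t ^ 2)
    rcases sq_eq_sq_iff_eq_or_eq_neg.1 h1 with h | h
    · exact hρ.ne_rat t h
    · exact hρ.ne_rat (-t) (by rw [h]; push_cast; rfl)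
  let K := QuadraticAlgebra ℚ r 0
  have hroot : ∀ t : ℝ, t ^ 2 = r → t * t = r • (1 : ℝ) + (0 : ℚ) • t := fun t ht => by
    rw [← pow_two, ht, zero_smul, Rat.smul_one_eq_cast, add_zero]
  let φ : ∀ t : ℝ, t ^ 2 = r → K →ₐ[ℚ] ℝ := fun t ht => QuadraticAlgebra.lift ⟨t, hroot t ht⟩
  have hφ : ∀ t ht (x : K), φ t ht x = x.re + x.im * t := fun t ht x => by
    change x.re • (1 : ℝ) + x.im • t = _
    rw [Rat.smul_def, Rat.smul_def, mul_one]
  let σ : Bool → K →+* ℝ := fun i =>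
    if i then (φ ρ hr : K →+* ℝ) else (φ (-ρ) (by rw [neg_sq, hr]) : K →+* ℝ)
  have : CharZero K := ⟨fun m n hmn => by
    have := congrArg (φ ρ hr) hmn
    simpa using this⟩
  let ω : K := ⟨0, 1⟩
  have hσt : ∀ x, σ true x = x.re + x.im * ρ := fun x => hφ ρ hr x
  have hσf : ∀ x, σ false x = x.re - x.im * ρ := fun x => (hφ (-ρ) (by rw [neg_sq, hr]) x).trans (by ring)
  have h1 : σ true ω = ρ := by rw [hσt]; simp [ω]
  have h2 : σ false ω = -ρ := by rw [hσf]; simp [ω]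
  have hirr : ∀ i, Irrational (σ i ω) := by
    rintro (_ | _)
    · rw [h2]; exact hρ.neg
    · rw [h1]; exact hρ
  have hden : ((r.den : ℤ) : ℝ) * ρ ^ 2 = r.num := by
    rw [hr]
    exact_mod_cast Rat.den_mul_eq_num r
  have hq : ∀ i, ((r.den : ℤ) : ℝ) * σ i ω ^ 2 + ((0 : ℤ) : ℝ) * σ i ω + ((-r.num : ℤ) : ℝ) = 0 := by
    rintro (_ | _)
    · rw [h2, neg_sq, hden]; push_cast; ring
    · rw [h1, hden]; push_cast; ring
  have hper := (isAdmissible_half (by exact_mod_cast r.den_ne_zero) hirr hq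
    hs).isPeriodic_secCsc_of_nonneg ha hb hab
  obtain ⟨x, hx⟩ := hper.exists_psi_eq (by omega) hpar
  exact ⟨x.re, x.im, by rw [← hσt, ← hx, h1], by rw [← hσf, ← hx, h2]⟩

lemma exists_psi_eq_pi_mul_pow {ρ : ℝ} (hρ : Irrational ρ) {r : ℚ} (hr : ρ ^ 2 = r) {a b : ℤ}
    {s : ℕ} (hs : 2 ≤ s) (ha : a < s) (hb : b < s) (hab : 0 ≤ a + b) (hpar : Even (b + s)) :
    ∃ q : ℚ, psi a b s ρ = (Real.pi * ρ) ^ s * q := by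
  obtain ⟨p, q, h1, h2⟩ := exists_psi_eq_of_sq_eq_rat hρ hr hs ha hb hab hpar
  have hb' : (-1 : ℝ) ^ b = (-1) ^ s := by
    have h := hpar.neg_one_zpow (α := ℝ)
    rw [zpow_add₀ (by norm_num), zpow_natCast] at h
    have h3 : ((-1 : ℝ) ^ s) * (-1) ^ s = 1 := by rw [← mul_pow]; norm_num
    linear_combination (-1 : ℝ) ^ s * h - (-1) ^ b * h3
  rw [psi_neg, hb', h1, mul_left_comm] at h2
  have h3 := mul_left_cancel₀ (pow_ne_zero s Real.pi_ne_zero) h2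
  have hρ0 := hρ.ne_zero
  have hr0 : (r : ℝ) ≠ 0 := by rw [← hr]; exact pow_ne_zero 2 hρ0
  obtain ⟨m, hm | hm⟩ := s.even_or_odd'
  · have h4 : (q : ℝ) * ρ = 0 := by
      rw [hm, pow_mul, neg_one_sq, one_pow] at h3
      linarith
    refine ⟨p / r ^ m, ?_⟩
    have h5 : ρ ^ s = (r : ℝ) ^ m := by rw [hm, pow_mul, hr]
    rw [h1, h4, mul_pow, h5]
    push_cast
    field_simp
    ring
  · have h4 : (p : ℝ) = 0 := by
      rw [hm, pow_succ, pow_mul, neg_one_sq, one_pow] at h3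
      linarith
    refine ⟨q / r ^ m, ?_⟩
    have h5 : ρ ^ s = (r : ℝ) ^ m * ρ := by rw [hm, pow_succ, pow_mul, hr]
    rw [h1, h4, mul_pow, h5]
    push_cast
    field_simp
    ring

end TrigDirichlet

theorem theorem1 (ρ : ℝ) (hρ : IsRealQuadraticIrrationality ρ) (a b s : ℤ)
    (hs : max (max a b) 1 + 1 ≤ s) (hparity : s ≡ b [ZMOD 2]) :
    Summable (psiTerm a b s ρ) ∧
      (∃ x ∈ IntermediateField.adjoin ℚ ({ρ} : Set ℝ), psi a b s ρ = Real.pi ^ s * x) ∧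
      ((∃ r : ℚ, ρ ^ 2 = (r : ℝ)) → 0 ≤ a + b →
        ∃ q : ℚ, psi a b s ρ = (Real.pi * ρ) ^ s * (q : ℝ)) := by
  obtain ⟨hirr, A, B, C, hA, hABC⟩ := hρ
  obtain ⟨s, rfl⟩ : ∃ k : ℕ, s = k := ⟨s.toNat, by omega⟩
  have hs2 : 2 ≤ s := by omega
  have ha : a < s := by omega
  have hb : b < s := by omega
  have hpar : Even (b + s) := by
    have := hparity.eq
    rw [Int.even_iff]
    omega
  let K := IntermediateField.adjoin ℚ ({ρ} : Set ℝ)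
  let ω : K := IntermediateField.AdjoinSimple.gen ℚ ρ
  let σ : Unit → K →+* ℝ := fun _ => algebraMap K ℝ
  have hω : ∀ i, σ i ω = ρ := fun _ => IntermediateField.AdjoinSimple.algebraMap_gen ℚ ρ
  have hper := (TrigDirichlet.isAdmissible_half (σ := σ) (ω := ω) hA
    (fun i => (hω i).symm ▸ hirr) (fun i => (hω i).symm ▸ hABC)
    hs2).isPeriodic_secCsc ha hb
  refine ⟨by simpa only [hω] using hper.summable_psiTerm (), ?_, ?_⟩
  · obtain ⟨x, hx⟩ := hper.exists_psi_eq (by omega) hpar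
    exact ⟨x, x.2, by rw [zpow_natCast, ← hω (), hx ()]; rfl⟩
  · rintro ⟨r, hr⟩ hab
    simpa only [zpow_natCast] using
      TrigDirichlet.exists_psi_eq_pi_mul_pow hirr hr hs2 ha hb hab hpar
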